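/- **Theorem (Stable Theorem).** Let $\mathbb K=\mathbb R$ or $\mathbb C$, let $n,k\ge 0$ be integers, and let $X$ be a compact affine real algebraic variety, i.e. (up to biregular isomorphism) the compact set of common real zeros in some $\mathbb R^m$ of a family of real polynomials. Assume that every topological $\mathbb K$-vector bundle of rank $k$ over $X$ is topologically isomorphic to an algebraic $\mathbb K$-vector bundle. Then the inclusion $$i:\mathrm{Alg}(X,\mathbb G_{n,k}(\mathbb K))\to \mathrm{Map}(X,\mathbb G_{n,k}(\mathbb K))$$ is a weak homotopy equivalence: it induces a bijection on path components and, for every $N\ge 1$ and every base point in $\mathrm{Alg}(X,\mathbb G_{n,k}(\mathbb K))$, an isomorphism on $\pi_N$. Here $\mathbb G_{n,k}(\mathbb K)$ is the Grassmannian of $k$-dimensional $\mathbb K$-subspaces of $\mathbb K^n$, with its usual topology and regarded as an affine real algebraic variety by identifying a subspace with the orthogonal projection onto it; $\mathrm{Map}(X,\mathbb G_{n,k}(\mathbb K))$ is the space of continuous maps with the compact-open topology, and $\mathrm{Alg}(X,\mathbb G_{n,k}(\mathbb K))$ is its subspace of algebraic (that is, regular) maps. A map between subsets of finite-dimensional real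 vector spaces is regular if each of its real coordinate functions is a quotient $g/h$ of real polynomials with $h$ nowhere zero on the source. An algebraic $\mathbb K$-vector bundle of rank $k$ over $X$ is one that is algebraically isomorphic to a pre-algebraic vector subbundle of a trivial bundle $X\times\mathbb K^p$, i.e. to a family of subspaces of $\mathbb K^p$ whose total space $E\subseteq X\times\mathbb K^p$ is a real algebraic set and such that $X$ is covered by Zariski open sets $U$ over which $E|_U$ is isomorphic to $U\times\mathbb K^k$ by a biregular, fibre-preserving, fibrewise $\mathbb K$-linear map. -/

import Mathlib

open Bundle Topology

universe u

namespace StableAlg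

noncomputable section

/-! ### Real algebraic sets and regular maps -/

section Regular

variable {V W : Type*} [AddCommGroup V] [Module ℝ V] [AddCommGroup W] [Module ℝ W]

/-- A real polynomial function on a (finite-dimensional) real vector space `V`: an element of the
`ℝ`-algebra of functions generated by the linear functionals.  For `V = ℝ^m` these are the
functions given by polynomials in the coordinates, see `isPolynomialFun_iff`. -/
def IsPolynomialFun (g : V → ℝ) : Prop :=
  g ∈ Algebra.adjoin ℝ (Set.range fun φ : Module.Dual ℝ V => (φ : V → ℝ))

/-- A real algebraic set: the set of common zeros of a family of polynomial functions. -/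
def IsAlgebraicSet (S : Set V) : Prop :=
  ∃ I : Set (V → ℝ), (∀ g ∈ I, IsPolynomialFun g) ∧ S = {x | ∀ g ∈ I, g x = 0}

/-- `U` is a Zariski open subset of `X`. -/
def IsZariskiOpenIn (X U : Set V) : Prop :=
  ∃ Z : Set V, IsAlgebraicSet Z ∧ U = X \ Z

/-- A real function on `S ⊆ V` is regular if it is a quotient `g / h` of two polynomial functions,
where `h` has no zero on `S`. -/
def IsRegularFun (S : Set V) (f : S → ℝ) : Prop :=
  ∃ g h : V → ℝ, IsPolynomialFun g ∧ IsPolynomialFun h ∧ (∀ x ∈ S, h x ≠ 0) ∧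
    ∀ x : S, f x = g x / h x

/-- A map from `S ⊆ V` to a finite-dimensional real vector space `W` is regular if its
(linear) coordinate functions are regular. -/
def IsRegularMap (S : Set V) (f : S → W) : Prop :=
  ∀ φ : Module.Dual ℝ W, IsRegularFun S fun x => φ (f x)

/-- A bijection between subsets of finite-dimensional real vector spaces is biregular if it and its
inverse are regular. -/
def IsBiregular {S : Set V} {T : Set W} (Φ : S ≃ T) : Prop :=
  IsRegularMap S (fun x => (Φ x : W)) ∧ IsRegularMap T (fun y => (Φ.symm y : V))

/-- On `ℝ^ι` the polynomial functions are exactly the functions given by polynomials. -/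
theorem isPolynomialFun_iff {ι : Type*} [Finite ι] (g : (ι → ℝ) → ℝ) :
    IsPolynomialFun g ↔ ∃ p : MvPolynomial ι ℝ, ∀ x, g x = MvPolynomial.eval x p := by
  have := Fintype.ofFinite ι
  classical
  constructor
  · intro hg
    refine Algebra.adjoin_induction (p := fun g _ => ∃ p : MvPolynomial ι ℝ,
      ∀ x, g x = MvPolynomial.eval x p) ?_ ?_ ?_ ?_ hg
    · rintro _ ⟨φ, rfl⟩
      refine ⟨∑ i, MvPolynomial.C (φ (Pi.single i 1)) * MvPolynomial.X i, fun x => ?_⟩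
      simp only [map_sum, map_mul, MvPolynomial.eval_C, MvPolynomial.eval_X]
      conv_lhs => rw [LinearMap.pi_apply_eq_sum_univ φ x]
      refine Finset.sum_congr rfl fun i _ => ?_
      rw [smul_eq_mul, mul_comm]
      congr 2
      ext j
      simp [Pi.single_apply, eq_comm]
    · intro r
      exact ⟨MvPolynomial.C r, fun x => by simp⟩
    · rintro f g _ _ ⟨p, hp⟩ ⟨q, hq⟩
      exact ⟨p + q, fun x => by simp [hp, hq]⟩
    · rintro f g _ _ ⟨p, hp⟩ ⟨q, hq⟩
      exact ⟨p * q, fun x => by simp [hp, hq]⟩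
  · rintro ⟨p, hp⟩
    obtain rfl : g = fun x => MvPolynomial.eval x p := funext hp
    clear hp
    unfold IsPolynomialFun
    induction p using MvPolynomial.induction_on with
    | C a =>
      simp only [MvPolynomial.eval_C]
      exact Subalgebra.algebraMap_mem _ a
    | add p q hp hq =>
      simp only [map_add]
      exact add_mem hp hq
    | mul_X p i hp =>
      simp only [map_mul, MvPolynomial.eval_X]
      exact mul_mem hp (Algebra.subset_adjoin ⟨LinearMap.proj i, rfl⟩)

end Regular

/-! ### The Grassmannian and the spaces of maps into it -/

/-- The Grassmannian of `k`-dimensional `𝕂`-subspaces of `𝕂^n`. -/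
def Grassmannian (𝕂 : Type*) [RCLike 𝕂] (n k : ℕ) : Type _ :=
  {L : Submodule 𝕂 (EuclideanSpace 𝕂 (Fin n)) // Module.finrank 𝕂 L = k}

/-- The embedding of the Grassmannian in the real vector space of endomorphisms of `𝕂^n`, sending a
subspace to the orthogonal projection onto it.  Its image is the real algebraic set of selfadjoint
idempotents of trace `k`; this is the structure of an affine real algebraic variety on the
Grassmannian. -/
def Grassmannian.proj {𝕂 : Type*} [RCLike 𝕂] {n k : ℕ} (L : Grassmannian 𝕂 n k) :
    EuclideanSpace 𝕂 (Fin n) →L[𝕂] EuclideanSpace 𝕂 (Fin n) :=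
  L.1.starProjection

/-- The usual topology of the Grassmannian, which makes `Grassmannian.proj` an embedding. -/
instance Grassmannian.instTopologicalSpace (𝕂 : Type*) [RCLike 𝕂] (n k : ℕ) : TopologicalSpace (Grassmannian 𝕂 n k) :=
  TopologicalSpace.induced Grassmannian.proj inferInstance

/-- The space of regular maps from `X ⊆ ℝ^m` to the Grassmannian, topologized as a subspace of the
space of continuous maps (with the compact-open topology). -/
abbrev AlgMap (𝕂 : Type*) [RCLike 𝕂] (n k : ℕ) {m : ℕ} (X : Set (Fin m → ℝ)) : Type _ :=
  {f : C(X, Grassmannian 𝕂 n k) // IsRegularMap X fun x => (f x).proj}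

/-- The inclusion of the space of regular maps in the space of continuous maps. -/
def algInclusion (𝕂 : Type*) [RCLike 𝕂] (n k : ℕ) {m : ℕ} (X : Set (Fin m → ℝ)) :
    C(AlgMap 𝕂 n k X, C(X, Grassmannian 𝕂 n k)) :=
  ⟨Subtype.val, continuous_subtype_val⟩

/-! ### Weak homotopy equivalences -/

section Weak

variable {A B : Type*} [TopologicalSpace A] [TopologicalSpace B]

/-- The map induced on path components by a continuous map. -/
def pi0Map (f : C(A, B)) : ZerothHomotopy A → ZerothHomotopy B :=
  Quotient.map f fun _ _ h => h.map f.continuous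

/-- The composition of a generalized loop with a continuous map. -/
def genLoopMap (f : C(A, B)) (N : Type*) (a : A) (γ : GenLoop N A a) : GenLoop N B (f a) :=
  ⟨f.comp γ.1, fun y hy => congrArg f (γ.2 y hy)⟩

/-- The map induced on the `N`-th homotopy group (with base point `a`) by a continuous map. -/
def piMap (f : C(A, B)) (N : ℕ) (a : A) : HomotopyGroup.Pi N A a → HomotopyGroup.Pi N B (f a) :=
  Quotient.map (genLoopMap f (Fin N) a) fun _ _ h => h.map fun H => H.compContinuousMap f

/-- A weak homotopy equivalence: a map which is bijective on path components, and bijective on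
(equivalently, since the induced maps are homomorphisms, an isomorphism of) the `N`-th homotopy
groups for all `N ≥ 1` and all base points of the source. -/
def IsWeakHomotopyEquiv (f : C(A, B)) : Prop :=
  Function.Bijective (pi0Map f) ∧
    ∀ N : ℕ, 1 ≤ N → ∀ a : A, Function.Bijective (piMap f N a)

end Weak

/-! ### Algebraic vector bundles -/

section Bundles

/-- The part over `U ⊆ ℝ^m` of the total space of a family of subspaces of `𝕂^p`, as a subset of
`ℝ^m × 𝕂^p`. -/
def totalOver {𝕂 : Type*} [RCLike 𝕂] {m p : ℕ} {X : Set (Fin m → ℝ)}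
    (fiber : X → Submodule 𝕂 (Fin p → 𝕂)) (U : Set (Fin m → ℝ)) :
    Set ((Fin m → ℝ) × (Fin p → 𝕂)) :=
  {q | q.1 ∈ U ∧ ∃ h : q.1 ∈ X, q.2 ∈ fiber ⟨q.1, h⟩}

/-- An algebraic `𝕂`-vector bundle of rank `k` over `X ⊆ ℝ^m`, realized (as every algebraic vector
bundle is, up to algebraic isomorphism, by definition) as a pre-algebraic vector subbundle of a
trivial bundle `X × 𝕂^p`: the total space is a real algebraic set, and `X` is covered by Zariski
open subsets `U` over which the bundle is biregularly isomorphic, by a fibre preserving and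
fibrewise linear map, to the trivial bundle `U × 𝕂^k`. -/
structure AlgebraicVectorBundle (𝕂 : Type*) [RCLike 𝕂] (k : ℕ) {m : ℕ}
    (X : Set (Fin m → ℝ)) where
  /-- the rank of the ambient trivial bundle -/
  p : ℕ
  /-- the fibres -/
  fiber : X → Submodule 𝕂 (Fin p → 𝕂)
  isAlgebraicSet_total : IsAlgebraicSet (totalOver fiber X)
  locally_trivial : ∀ x₀ ∈ X, ∃ U : Set (Fin m → ℝ), IsZariskiOpenIn X U ∧ x₀ ∈ U ∧
    ∃ Φ : (U ×ˢ Set.univ : Set ((Fin m → ℝ) × (Fin k → 𝕂))) ≃ totalOver fiber U,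
      IsBiregular Φ ∧
      (∀ q, (Φ q).1.1 = q.1.1) ∧
      ∀ (x : Fin m → ℝ) (hx : x ∈ U),
        IsLinearMap 𝕂 fun v : Fin k → 𝕂 => (Φ ⟨(x, v), ⟨hx, Set.mem_univ v⟩⟩).1.2

/-- The total space of an algebraic vector bundle, with the topology of a subspace of `X × 𝕂^p`. -/
abbrev AlgebraicVectorBundle.Total {𝕂 : Type*} [RCLike 𝕂] {k m : ℕ} {X : Set (Fin m → ℝ)}
    (ξ : AlgebraicVectorBundle 𝕂 k X) : Type _ :=
  {q : X × (Fin ξ.p → 𝕂) // q.2 ∈ ξ.fiber q.1}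

/-- Every topological `𝕂`-vector bundle of rank `k` over `X` is topologically isomorphic to an
algebraic `𝕂`-vector bundle: there are linear isomorphisms of the fibres which together
form a homeomorphism of the total spaces. -/
def EveryBundleAlgebraic (𝕂 : Type u) [RCLike 𝕂] (k : ℕ) {m : ℕ} (X : Set (Fin m → ℝ)) : Prop :=
  ∀ (E : X → Type u)
    [∀ x, AddCommGroup (E x)] [∀ x, Module 𝕂 (E x)] [∀ x, TopologicalSpace (E x)]
    [TopologicalSpace (TotalSpace (Fin k → 𝕂) E)]
    [FiberBundle (Fin k → 𝕂) E] [VectorBundle 𝕂 (Fin k → 𝕂) E],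
    ∃ (ξ : AlgebraicVectorBundle 𝕂 k X) (ψ : ∀ x, E x ≃ₗ[𝕂] ξ.fiber x),
      IsHomeomorph fun e : TotalSpace (Fin k → 𝕂) E =>
        (⟨(e.proj, (ψ e.proj e.2 : Fin ξ.p → 𝕂)), (ψ e.proj e.2).2⟩ : ξ.Total)

end Bundles

end

end StableAlg

namespace StableAlg

/-! ### Calculus of regular maps -/

section RegularCalculus

variable {V W W₁ W₂ W₃ : Type*} [AddCommGroup V] [Module ℝ V] [AddCommGroup W] [Module ℝ W]
  [AddCommGroup W₁] [Module ℝ W₁] [AddCommGroup W₂] [Module ℝ W₂] [AddCommGroup W₃] [Module ℝ W₃]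
  {S : Set V}

/-! A map to the Grassmannian is a family `P(x)` of orthogonal projections, and it is regular
exactly when its entries are. The central device is `imageProj`: if `P` is a projection, `A = A P`
and `A` is injective on the range of `P`, then `A (A†A + 1 - P)⁻¹ A†` is the orthogonal projection
onto the image of `A`. Being rational in `A` and `P`, it preserves both continuity and regularity.

By hypothesis the pull-back of the tautological bundle under a continuous `f` is isomorphic to an
algebraic bundle. The projections `E(x)` onto the fibres of the latter are regular
(`AlgebraicVectorBundle.isRegularMap_starProjection`), and the isomorphism is a continuous family of
operators `Φ(x)`. Approximating `Φ` by a regular `Q` (Stone–Weierstrass) and projecting onto the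
image of `Q E` gives a regular map near `f`. Over a compact contractible parameter space `D`,
homotopy invariance (`exists_continuous_conj`) reduces a family to a single map, and the same
approximation over `D × X` works, regularity being demanded only in `x` (`exists_regular_family`).

Nearby projections `P`, `R` are joined by projecting onto the image of `((1 - t) P + t R) P`. For
fixed `t` this is regular when `P` and `R` are, so the resulting deformation keeps regular maps
regular (`exists_deformation`). Applied to cubes whose boundary collars already lie in the subspace,
such deformations give bijections on `π₀` and on all `π_N` (`HasDeformations.isWeakHomotopyEquiv`).
-/

theorem IsPolynomialFun.add {g h : V → ℝ} (hg : IsPolynomialFun g) (hh : IsPolynomialFun h) :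
    IsPolynomialFun (g + h) := add_mem hg hh

theorem IsPolynomialFun.mul {g h : V → ℝ} (hg : IsPolynomialFun g) (hh : IsPolynomialFun h) :
    IsPolynomialFun (g * h) := mul_mem hg hh

theorem isPolynomialFun_const (r : ℝ) : IsPolynomialFun (fun _ : V => r) :=
  Subalgebra.algebraMap_mem _ r

theorem isPolynomialFun_dual (φ : Module.Dual ℝ V) : IsPolynomialFun (φ : V → ℝ) :=
  Algebra.subset_adjoin ⟨φ, rfl⟩

theorem isPolynomialFun_sum {ι : Type*} (s : Finset ι) {g : ι → V → ℝ}
    (h : ∀ i ∈ s, IsPolynomialFun (g i)) : IsPolynomialFun (∑ i ∈ s, g i) := sum_mem h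

/-- The pull-back of a polynomial function under an affine map. -/
theorem IsPolynomialFun.comp_affine {g : W → ℝ} (hg : IsPolynomialFun g) (L : V →ₗ[ℝ] W) (w : W) :
    IsPolynomialFun fun x => g (L x + w) := by
  refine Algebra.adjoin_induction (p := fun g _ => IsPolynomialFun fun x => g (L x + w))
    ?_ ?_ ?_ ?_ hg
  · rintro _ ⟨φ, rfl⟩
    have := (isPolynomialFun_dual (φ ∘ₗ L)).add (isPolynomialFun_const (φ w))
    convert this using 1
    ext x
    simp
  · intro r
    exact isPolynomialFun_const r
  · intro f g _ _ hf hg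
    exact hf.add hg
  · intro f g _ _ hf hg
    exact hf.mul hg

theorem IsPolynomialFun.continuous {V : Type*} [NormedAddCommGroup V] [NormedSpace ℝ V]
    [FiniteDimensional ℝ V] {g : V → ℝ} (hg : IsPolynomialFun g) : Continuous g := by
  refine Algebra.adjoin_induction (p := fun g _ => Continuous g) ?_ ?_ ?_ ?_ hg
  · rintro _ ⟨φ, rfl⟩
    exact φ.continuous_of_finiteDimensional
  · intro r
    exact continuous_const
  · intro f g _ _ hf hg
    exact hf.add hg
  · intro f g _ _ hf hg
    exact hf.mul hg

theorem IsPolynomialFun.isRegularFun {g : V → ℝ} (hg : IsPolynomialFun g) :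
    IsRegularFun S fun x => g x :=
  ⟨g, fun _ => 1, hg, isPolynomialFun_const 1, fun _ _ => one_ne_zero, fun x => by simp⟩

/-- The algebra of regular functions on `S`. -/
def regularFunctions (S : Set V) : Subalgebra ℝ (S → ℝ) where
  carrier := {f | IsRegularFun S f}
  mul_mem' := by
    rintro f₁ f₂ ⟨g₁, h₁, hg₁, hh₁, h0₁, hf₁⟩ ⟨g₂, h₂, hg₂, hh₂, h0₂, hf₂⟩
    refine ⟨g₁ * g₂, h₁ * h₂, hg₁.mul hg₂, hh₁.mul hh₂,
      fun x hx => mul_ne_zero (h0₁ x hx) (h0₂ x hx), fun x => ?_⟩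
    simp only [Pi.mul_apply, hf₁, hf₂]
    rw [div_mul_div_comm]
  add_mem' := by
    rintro f₁ f₂ ⟨g₁, h₁, hg₁, hh₁, h0₁, hf₁⟩ ⟨g₂, h₂, hg₂, hh₂, h0₂, hf₂⟩
    refine ⟨g₁ * h₂ + h₁ * g₂, h₁ * h₂, (hg₁.mul hh₂).add (hh₁.mul hg₂), hh₁.mul hh₂,
      fun x hx => mul_ne_zero (h0₁ x hx) (h0₂ x hx), fun x => ?_⟩
    simp only [Pi.add_apply, Pi.mul_apply, hf₁, hf₂]
    rw [div_add_div _ _ (h0₁ x x.2) (h0₂ x x.2)]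
  algebraMap_mem' r := (isPolynomialFun_const r).isRegularFun

theorem IsRegularFun.inv {f : S → ℝ} (hf : IsRegularFun S f) (h0 : ∀ x, f x ≠ 0) :
    IsRegularFun S fun x => (f x)⁻¹ := by
  obtain ⟨g, h, hg, hh, h0', hf⟩ := hf
  refine ⟨h, g, hh, hg, fun x hx hgx => h0 ⟨x, hx⟩ ?_, fun x => by
    simp only [hf, inv_div]⟩
  rw [hf]
  simp [hgx]

theorem IsRegularFun.continuous {V : Type*} [NormedAddCommGroup V] [NormedSpace ℝ V]
    [FiniteDimensional ℝ V] {S : Set V} {f : S → ℝ} (hf : IsRegularFun S f) : Continuous f := by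
  obtain ⟨g, h, hg, hh, h0, hf⟩ := hf
  obtain rfl : f = fun x : S => g x / h x := funext hf
  exact (hg.continuous.comp continuous_subtype_val).div
    (hh.continuous.comp continuous_subtype_val) fun x => h0 x x.2

theorem isRegularMap_const (w : W) : IsRegularMap S fun _ => w :=
  fun φ => (isPolynomialFun_const (φ w)).isRegularFun

theorem IsRegularMap.comp_linear {f : S → W₁} (hf : IsRegularMap S f) (L : W₁ →ₗ[ℝ] W₂) :
    IsRegularMap S fun x => L (f x) := fun φ => hf (φ ∘ₗ L)

theorem IsRegularMap.add {f g : S → W} (hf : IsRegularMap S f) (hg : IsRegularMap S g) :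
    IsRegularMap S fun x => f x + g x := fun φ => by
  simp only [map_add]
  exact (regularFunctions S).add_mem (hf φ) (hg φ)

theorem IsRegularMap.sub {f g : S → W} (hf : IsRegularMap S f) (hg : IsRegularMap S g) :
    IsRegularMap S fun x => f x - g x := fun φ => by
  simp only [map_sub]
  exact (regularFunctions S).sub_mem (hf φ) (hg φ)

theorem IsRegularMap.const_smul {f : S → W} (hf : IsRegularMap S f) (c : ℝ) :
    IsRegularMap S fun x => c • f x := hf.comp_linear (c • LinearMap.id)

theorem isRegularMap_iff_basis {ι : Type*} [Finite ι] (b : Module.Basis ι ℝ W) {f : S → W} :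
    IsRegularMap S f ↔ ∀ i, IsRegularFun S fun x => b.repr (f x) i := by
  have := Fintype.ofFinite ι
  refine ⟨fun h i => h (b.coord i), fun h φ => ?_⟩
  have : (fun x => φ (f x)) = ∑ i, φ (b i) • fun x => b.repr (f x) i := by
    ext x
    conv_lhs => rw [← b.sum_repr (f x)]
    simp only [map_sum, map_smul, Finset.sum_apply, Pi.smul_apply, smul_eq_mul]
    exact Finset.sum_congr rfl fun i _ => mul_comm _ _
  rw [this]
  exact (regularFunctions S).sum_mem
    fun i _ => Subalgebra.smul_mem _ (h i) _

theorem IsRegularMap.bilin [FiniteDimensional ℝ W₁] [FiniteDimensional ℝ W₂]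
    (B : W₁ →ₗ[ℝ] W₂ →ₗ[ℝ] W₃) {f : S → W₁} {g : S → W₂}
    (hf : IsRegularMap S f) (hg : IsRegularMap S g) : IsRegularMap S fun x => B (f x) (g x) := by
  intro φ
  let b := Module.finBasis ℝ W₁
  let c := Module.finBasis ℝ W₂
  have : (fun x => φ (B (f x) (g x))) = ∑ i, ∑ j, φ (B (b i) (c j)) •
      ((fun x => b.repr (f x) i) * fun x => c.repr (g x) j) := by
    ext x
    conv_lhs => rw [← b.sum_repr (f x), ← c.sum_repr (g x)]
    simp only [map_sum, map_smul, LinearMap.sum_apply, LinearMap.smul_apply, Finset.sum_apply,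
      Pi.smul_apply, Pi.mul_apply, smul_eq_mul, Finset.mul_sum]
    rw [Finset.sum_comm]
    refine Finset.sum_congr rfl fun i _ => Finset.sum_congr rfl fun j _ => ?_
    ring
  rw [this]
  exact (regularFunctions S).sum_mem fun i _ =>
    (regularFunctions S).sum_mem fun j _ => Subalgebra.smul_mem _ (mul_mem (hf (b.coord i)) (hg (c.coord j))) _

/-- Cramer's rule: the entries of the inverse of a matrix of regular functions are regular. -/
theorem isRegularFun_matrix_inv {ι : Type*} [Fintype ι] [DecidableEq ι] {M : S → Matrix ι ι ℝ}
    (hM : ∀ i j, IsRegularFun S fun x => M x i j) (hu : ∀ x, IsUnit (M x)) (i j : ι) :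
    IsRegularFun S fun x => (M x)⁻¹ i j := by
  -- Over the commutative ring of regular functions the determinant and the adjugate are regular by
  -- construction; evaluation at a point is a ring homomorphism and commutes with both.
  let N : Matrix ι ι (regularFunctions S) := fun i j => ⟨fun x => M x i j, hM i j⟩
  let ev (x : S) : regularFunctions S →+* ℝ :=
    (Pi.evalRingHom (fun _ : S => ℝ) x).comp (regularFunctions S).val.toRingHom
  have hN (x : S) : M x = (ev x).mapMatrix N := rfl
  have hdet (x : S) : (M x).det = (N.det : S → ℝ) x := by
    rw [hN, ← RingHom.map_det]
    rfl
  have hadj (x : S) : (M x).adjugate i j = (N.adjugate i j : S → ℝ) x := by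
    rw [hN, ← RingHom.map_adjugate]
    rfl
  have : (fun x => (M x)⁻¹ i j) =
      (fun x => ((N.det : S → ℝ) x)⁻¹) * (N.adjugate i j : S → ℝ) := by
    ext x
    rw [Matrix.inv_def, Matrix.smul_apply, Ring.inverse_eq_inv', hdet, hadj]
    rfl
  rw [this]
  refine (regularFunctions S).mul_mem ?_ (N.adjugate i j).2
  refine IsRegularFun.inv N.det.2 fun x => ?_
  rw [← hdet]
  exact ((Matrix.isUnit_iff_isUnit_det _).1 (hu x)).ne_zero

/-- Inversion in a finite-dimensional algebra is regular. -/
theorem IsRegularMap.ringInverse {A : Type*} [Ring A] [Algebra ℝ A] [FiniteDimensional ℝ A]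
    {f : S → A} (hf : IsRegularMap S f) (hu : ∀ x, IsUnit (f x)) :
    IsRegularMap S fun x => Ring.inverse (f x) := by
  classical
  let b := Module.finBasis ℝ A
  -- The left regular representation reduces inversion to matrices: the coordinates of `a⁻¹` are
  -- those of `1` multiplied by the inverse matrix of `a`.
  let ρ : A →ₐ[ℝ] Matrix _ _ ℝ := Algebra.leftMulMatrix b
  have hρ : ∀ i j, IsRegularFun S fun x => (ρ (f x))⁻¹ i j := by
    refine isRegularFun_matrix_inv (fun i j => ?_) fun x => (hu x).map ρ
    exact (hf.comp_linear ρ.toLinearMap) (Matrix.entryLinearMap ℝ ℝ i j)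
  refine (isRegularMap_iff_basis b).2 fun i => ?_
  have : (fun x => b.repr (Ring.inverse (f x)) i) =
      ∑ j, (b.repr 1 j) • fun x => (ρ (f x))⁻¹ i j := by
    ext x
    obtain ⟨v, hv⟩ := hu x
    have h1 : (ρ (f x))⁻¹ = ρ (Ring.inverse (f x)) := by
      refine Matrix.inv_eq_left_inv ?_
      rw [← map_mul, Ring.inverse_mul_cancel _ (hu x), map_one]
    have h2 := congrFun (Algebra.leftMulMatrix_mulVec_repr b (Ring.inverse (f x)) 1) i
    rw [mul_one] at h2
    rw [← h2, Finset.sum_apply, Matrix.mulVec, dotProduct]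
    refine Finset.sum_congr rfl fun j _ => ?_
    rw [Pi.smul_apply, h1, smul_eq_mul, mul_comm]
  rw [this]
  exact (regularFunctions S).sum_mem
    fun j _ => Subalgebra.smul_mem _ (hρ i j) _

theorem IsRegularMap.continuous {V W : Type*} [NormedAddCommGroup V] [NormedSpace ℝ V]
    [FiniteDimensional ℝ V] [NormedAddCommGroup W] [NormedSpace ℝ W] [FiniteDimensional ℝ W]
    {S : Set V} {f : S → W} (hf : IsRegularMap S f) : Continuous f := by
  let b := Module.finBasis ℝ W
  have : f = fun x => ∑ i, b.repr (f x) i • b i := funext fun x => (b.sum_repr (f x)).symm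
  rw [this]
  exact continuous_finsetSum _ fun i _ => ((hf (b.coord i)).continuous).smul continuous_const

/-- Being regular is local for the Zariski topology. -/
theorem isRegularFun_of_locally {V : Type*} [NormedAddCommGroup V] [NormedSpace ℝ V]
    [FiniteDimensional ℝ V] {S : Set V} (hS : IsCompact S) {f : S → ℝ}
    (h : ∀ x₀ : S, ∃ U : Set V, IsZariskiOpenIn S U ∧ x₀.1 ∈ U ∧ ∃ hU : U ⊆ S,
      IsRegularFun U fun x => f ⟨x, hU x.2⟩) : IsRegularFun S f := by
  -- If `f = g / h` off the zeros of a polynomial `z`, then `f (hz)² = g h z²` on all of `S`, since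
  -- both sides vanish where `z` does. The square makes the denominators nonnegative, so that they
  -- can be added without cancellation.
  have key : ∀ x₀ : S, ∃ a c : V → ℝ, IsPolynomialFun a ∧ IsPolynomialFun c ∧ c x₀ ≠ 0 ∧
      (∀ x, 0 ≤ c x) ∧ ∀ x : S, f x * c x = a x := by
    intro x₀
    obtain ⟨U, ⟨Z, ⟨I, hI, rfl⟩, rfl⟩, hx₀, hU, g, h, hg, hh, h0, hf⟩ := h x₀
    have : ∃ z ∈ I, z x₀ ≠ 0 := by
      have := hx₀.2
      simpa using this
    obtain ⟨z, hz, hz0⟩ := this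
    refine ⟨g * h * (z * z), (h * z) * (h * z), (hg.mul hh).mul ((hI z hz).mul (hI z hz)),
      (hh.mul (hI z hz)).mul (hh.mul (hI z hz)),
      mul_self_ne_zero.2 (mul_ne_zero (h0 _ hx₀) hz0), fun x => mul_self_nonneg _, fun x => ?_⟩
    simp only [Pi.mul_apply]
    by_cases hzx : z x = 0
    · simp [hzx]
    · have hx : x.1 ∈ S \ {x | ∀ g ∈ I, g x = 0} := ⟨x.2, fun H => hzx (H z hz)⟩
      have h1 := hf ⟨x, hx⟩
      have h2 := h0 x hx
      simp only at h1
      rw [h1]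
      field_simp
  choose a c ha hc hc0 hcpos hac using key
  -- Finitely many of the denominators have no common zero on `S`, so their sum is positive there
  -- and `f = (∑ a) / (∑ c)`.
  have hSc : CompactSpace S := isCompact_iff_compactSpace.1 hS
  obtain ⟨t, ht⟩ := CompactSpace.elim_nhds_subcover (fun x₀ : S => {x : S | c x₀ x ≠ 0})
    fun x₀ => (isOpen_ne_fun ((hc x₀).continuous.comp continuous_subtype_val)
      continuous_const).mem_nhds (hc0 x₀)
  have hpos : ∀ x : S, 0 < ∑ i ∈ t, c i x := by
    intro x
    have hx : x ∈ ⋃ x₀ ∈ t, {x : S | c x₀ x ≠ 0} := by rw [ht]; trivial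
    simp only [Set.mem_iUnion] at hx
    obtain ⟨i, hi, hix⟩ := hx
    exact Finset.sum_pos' (fun j _ => hcpos j x) ⟨i, hi, lt_of_le_of_ne (hcpos i x) (Ne.symm hix)⟩
  refine ⟨∑ i ∈ t, a i, ∑ i ∈ t, c i, isPolynomialFun_sum _ fun i _ => ha i,
    isPolynomialFun_sum _ fun i _ => hc i, fun x hx => ?_, fun x => ?_⟩
  · rw [Finset.sum_apply]
    exact (hpos ⟨x, hx⟩).ne'
  · rw [Finset.sum_apply, Finset.sum_apply, eq_div_iff (hpos x).ne', Finset.mul_sum]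
    exact Finset.sum_congr rfl fun i _ => hac i x

end RegularCalculus

end StableAlg

namespace StableAlg

noncomputable section

/-! ### Orthogonal projections on images -/

section Projections

open ContinuousLinearMap

variable {𝕂 V₁ V₂ : Type*} [RCLike 𝕂] [NormedAddCommGroup V₁] [InnerProductSpace 𝕂 V₁]
  [CompleteSpace V₁] [NormedAddCommGroup V₂] [InnerProductSpace 𝕂 V₂] [CompleteSpace V₂]

theorem isUnit_of_forall_apply_eq_zero [FiniteDimensional 𝕂 V₁] {T : V₁ →L[𝕂] V₁} (h : ∀ v, T v = 0 → v = 0) :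
    IsUnit T := by
  rw [isUnit_iff_bijective]
  have hinj : Function.Injective (T : V₁ →ₗ[𝕂] V₁) :=
    (injective_iff_map_eq_zero (T : V₁ →ₗ[𝕂] V₁)).2 h
  exact ⟨hinj, LinearMap.injective_iff_surjective.1 hinj⟩

theorem eq_zero_of_isUnit {T : V₁ →L[𝕂] V₁} (hT : IsUnit T) {v : V₁} (h : T v = 0) :
    v = 0 :=
  (isUnit_iff_bijective.1 hT).1 (h.trans (map_zero T).symm)

/-- The operator `A†A + (1 - P)`, where `P` is thought of as the orthogonal projection onto the
coimage of `A`. -/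
def gram (A : V₁ →L[𝕂] V₂) (P : V₁ →L[𝕂] V₁) : V₁ →L[𝕂] V₁ := adjoint A ∘L A + (1 - P)

/-- A rational formula for the orthogonal projection onto the image of `A`. -/
def imageProj (A : V₁ →L[𝕂] V₂) (P : V₁ →L[𝕂] V₁) : V₂ →L[𝕂] V₂ :=
  A ∘L Ring.inverse (gram A P) ∘L adjoint A

variable {A : V₁ →L[𝕂] V₂} {P : V₁ →L[𝕂] V₁}

theorem starProjection_apply_apply (hP : IsStarProjection P) (v : V₁) : P (P v) = P v := by
  conv_rhs => rw [← hP.isIdempotentElem.eq]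
  rfl

theorem starProjection_inner_apply (hP : IsStarProjection P) (v w : V₁) :
    inner 𝕂 (P v) w = inner 𝕂 v (P w) := by
  conv_rhs => rw [← hP.isSelfAdjoint.adjoint_eq, adjoint_inner_right]

theorem mem_range_starProjection_iff (hP : IsStarProjection P) {v : V₁} :
    v ∈ P.range ↔ P v = v := by
  constructor
  · rintro ⟨w, rfl⟩
    exact starProjection_apply_apply hP w
  · exact fun h => ⟨v, h⟩

/-- The quadratic form of the Gram operator is `‖A v‖² + ‖v - P v‖²`, so a kernel vector is fixed by
`P` and killed by `A`. -/
theorem isUnit_gram [FiniteDimensional 𝕂 V₁] (hP : IsStarProjection P) (h : ∀ v, P v = v → A v = 0 → v = 0) :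
    IsUnit (gram A P) := by
  refine isUnit_of_forall_apply_eq_zero fun v hv => ?_
  have h1 : inner 𝕂 (gram A P v) v = inner 𝕂 (A v) (A v) + inner 𝕂 (v - P v) (v - P v) := by
    have : inner 𝕂 (v - P v) (P v) = (0 : 𝕂) := by
      rw [← starProjection_inner_apply hP, map_sub, starProjection_apply_apply hP, sub_self,
        inner_zero_left]
    rw [inner_sub_right (v - P v), this, sub_zero]
    simp [gram, inner_add_left, adjoint_inner_left]
  rw [hv, inner_zero_left, inner_self_eq_norm_sq_to_K, inner_self_eq_norm_sq_to_K] at h1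
  have h2 : (0 : ℝ) = ‖A v‖ ^ 2 + ‖v - P v‖ ^ 2 := by exact_mod_cast h1
  have h3 : ‖A v‖ = 0 := by nlinarith [sq_nonneg ‖A v‖, sq_nonneg ‖v - P v‖]
  have h4 : ‖v - P v‖ = 0 := by nlinarith [sq_nonneg ‖A v‖, sq_nonneg ‖v - P v‖]
  exact h v (sub_eq_zero.1 (norm_eq_zero.1 h4)).symm (norm_eq_zero.1 h3)

theorem gram_apply_of_eq (A : V₁ →L[𝕂] V₂) {v : V₁} (hv : P v = v) :
    gram A P v = adjoint A (A v) := by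
  simp [gram, hv]

theorem eq_zero_of_isUnit_gram (hu : IsUnit (gram A P)) {v : V₁} (hv : P v = v) (hA : A v = 0) :
    v = 0 := by
  refine eq_zero_of_isUnit hu ?_
  rw [gram_apply_of_eq A hv, hA, map_zero]

/-- On the range of `P` the Gram operator is `A†A`, so its inverse undoes `A†A` there; as `A = A P`,
vectors of that range suffice. -/
theorem imageProj_apply (hP : IsStarProjection P) (hA : A ∘L P = A) (hu : IsUnit (gram A P))
    (v : V₁) : imageProj A P (A v) = A v := by
  have hA' : A (P v) = A v := congrArg (fun T : V₁ →L[𝕂] V₂ => T v) hA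
  have h1 : adjoint A (A v) = gram A P (P v) := by
    rw [gram_apply_of_eq A (starProjection_apply_apply hP v), hA']
  have h2 : Ring.inverse (gram A P) (gram A P (P v)) = P v :=
    congrArg (fun T : V₁ →L[𝕂] V₁ => T (P v)) (Ring.inverse_mul_cancel _ hu)
  simp only [imageProj, coe_comp, Function.comp_apply, h1, h2, hA']

theorem isSelfAdjoint_gram (hP : IsStarProjection P) : IsSelfAdjoint (gram A P) := by
  unfold gram
  refine IsSelfAdjoint.add ?_ (hP.one_sub.isSelfAdjoint)
  rw [isSelfAdjoint_iff', adjoint_comp, adjoint_adjoint]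

theorem range_imageProj (hP : IsStarProjection P) (hA : A ∘L P = A) (hu : IsUnit (gram A P)) :
    (imageProj A P).range = A.range := by
  apply le_antisymm
  · rintro _ ⟨v, rfl⟩
    exact ⟨_, rfl⟩
  · rintro _ ⟨v, rfl⟩
    exact ⟨A v, imageProj_apply hP hA hu v⟩

theorem isStarProjection_imageProj (hP : IsStarProjection P) (hA : A ∘L P = A)
    (hu : IsUnit (gram A P)) : IsStarProjection (imageProj A P) where
  isIdempotentElem := by
    ext v
    exact imageProj_apply hP hA hu _
  isSelfAdjoint := by
    have h : adjoint (Ring.inverse (gram A P)) = Ring.inverse (gram A P) := by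
      rw [← star_eq_adjoint, ← Ring.inverse_star, (isSelfAdjoint_gram hP).star_eq]
    rw [isSelfAdjoint_iff']
    simp only [imageProj, adjoint_comp, adjoint_adjoint, h]
    rfl

/-- An orthogonal projection is determined by its range. This identifies the rational formula with a
projection given geometrically. -/
theorem imageProj_eq (hP : IsStarProjection P) (hA : A ∘L P = A) (hu : IsUnit (gram A P))
    {Q : V₂ →L[𝕂] V₂} (hQ : IsStarProjection Q) (h : Q.range = A.range) : imageProj A P = Q :=
  IsStarProjection.ext (isStarProjection_imageProj hP hA hu) hQ
    ((range_imageProj hP hA hu).trans h.symm)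

theorem finrank_range_imageProj (hP : IsStarProjection P) (hA : A ∘L P = A)
    (hu : IsUnit (gram A P)) :
    Module.finrank 𝕂 (imageProj A P).range = Module.finrank 𝕂 P.range := by
  rw [range_imageProj hP hA hu]
  have h1 : A.range = P.range.map (A : V₁ →ₗ[𝕂] V₂) := by
    conv_lhs => rw [← hA]
    exact LinearMap.range_comp _ _
  rw [h1]
  have hinj : Function.Injective ((A : V₁ →ₗ[𝕂] V₂).domRestrict P.range) := by
    refine (injective_iff_map_eq_zero _).2 fun v hv => Subtype.ext ?_
    exact eq_zero_of_isUnit_gram hu ((mem_range_starProjection_iff hP).1 v.2) hv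
  rw [← LinearMap.finrank_range_of_inj hinj, LinearMap.range_domRestrict]

/-! ### Continuous dependence of image projections on parameters -/

theorem continuous_ringInverse {Y R : Type*} [TopologicalSpace Y] [NormedRing R]
    [HasSummableGeomSeries R] {f : Y → R} (hf : Continuous f) (hu : ∀ y, IsUnit (f y)) :
    Continuous fun y => Ring.inverse (f y) := by
  rw [continuous_iff_continuousAt]
  intro y
  obtain ⟨u, h⟩ := hu y
  have := NormedRing.inverse_continuousAt u
  rw [h] at this
  exact this.comp hf.continuousAt

theorem continuous_adjoint_comp {Y : Type*} [TopologicalSpace Y] {A : Y → V₁ →L[𝕂] V₂}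
    (hA : Continuous A) : Continuous fun y => adjoint (A y) :=
  (adjoint (𝕜 := 𝕂) (E := V₁) (F := V₂)).continuous.comp hA

theorem continuous_gram {Y : Type*} [TopologicalSpace Y] {A : Y → V₁ →L[𝕂] V₂}
    {P : Y → V₁ →L[𝕂] V₁} (hA : Continuous A) (hP : Continuous P) :
    Continuous fun y => gram (A y) (P y) :=
  ((continuous_adjoint_comp hA).clm_comp hA).add (continuous_const.sub hP)

theorem continuous_imageProj {Y : Type*} [TopologicalSpace Y] {A : Y → V₁ →L[𝕂] V₂}
    {P : Y → V₁ →L[𝕂] V₁} (hA : Continuous A) (hP : Continuous P)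
    (hu : ∀ y, IsUnit (gram (A y) (P y))) : Continuous fun y => imageProj (A y) (P y) :=
  hA.clm_comp ((continuous_ringInverse (continuous_gram hA hP) hu).clm_comp
    (continuous_adjoint_comp hA))

/-! ### Intertwining two projections -/

/-- For nearby projections `P` and `Q`, an invertible operator which conjugates `Q` into `P`. -/
def intertwiner (P Q : V₁ →L[𝕂] V₁) : V₁ →L[𝕂] V₁ := P * Q + (1 - P) * (1 - Q)

variable {Q : V₁ →L[𝕂] V₁}

/-- Since units form an open set, the intertwiner of nearby projections is invertible; its
invertibility is the notion of closeness used below. -/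
theorem intertwiner_self (hP : IsStarProjection P) : intertwiner P P = 1 := by
  have h := hP.isIdempotentElem.eq
  have : P * P + (1 - P) * (1 - P) = 1 + (P * P - P) + (P * P - P) := by noncomm_ring
  rw [intertwiner, this, h]
  simp

theorem mul_intertwiner (hP : IsStarProjection P) :
    P * intertwiner P Q = P * Q := by
  have h := hP.isIdempotentElem.eq
  have : P * (P * Q + (1 - P) * (1 - Q)) = P * P * Q + (P - P * P) * (1 - Q) := by noncomm_ring
  rw [intertwiner, this, h]
  simp

theorem intertwiner_mul (hQ : IsStarProjection Q) :
    intertwiner P Q * Q = P * Q := by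
  have h := hQ.isIdempotentElem.eq
  have : (P * Q + (1 - P) * (1 - Q)) * Q = P * (Q * Q) + (1 - P) * (Q - Q * Q) := by noncomm_ring
  rw [intertwiner, this, h]
  simp

/-- Both sides equal `P * Q`, the cross terms vanishing by idempotence. -/
theorem intertwiner_mul_eq (hP : IsStarProjection P) (hQ : IsStarProjection Q) :
    intertwiner P Q * Q = P * intertwiner P Q := by
  rw [intertwiner_mul hQ, mul_intertwiner hP]

theorem star_intertwiner (hP : IsStarProjection P) (hQ : IsStarProjection Q) :
    star (intertwiner P Q) = intertwiner Q P := by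
  have hP' := hP.isSelfAdjoint.star_eq
  have hQ' := hQ.isSelfAdjoint.star_eq
  simp [intertwiner, hP', hQ']

theorem isUnit_intertwiner_symm (hP : IsStarProjection P) (hQ : IsStarProjection Q)
    (h : IsUnit (intertwiner P Q)) : IsUnit (intertwiner Q P) := by
  rw [← star_intertwiner hP hQ]
  exact h.star

theorem continuous_intertwiner {Y : Type*} [TopologicalSpace Y] {P Q : Y → V₁ →L[𝕂] V₁}
    (hP : Continuous P) (hQ : Continuous Q) : Continuous fun y => intertwiner (P y) (Q y) :=
  (hP.mul hQ).add ((continuous_const.sub hP).mul (continuous_const.sub hQ))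

/-- A bijective operator that conjugates `P` into `Q` maps the range of `P` onto that of `Q`. -/
theorem range_comp_of_mul_eq {U : V₁ →L[𝕂] V₁} (hU : IsUnit U) (h : U * P = Q * U) :
    (U ∘L P).range = Q.range := by
  have h' : U ∘L P = Q ∘L U := h
  rw [h']
  apply le_antisymm
  · rintro _ ⟨v, rfl⟩
    exact ⟨U v, rfl⟩
  · rintro _ ⟨v, rfl⟩
    obtain ⟨w, rfl⟩ := (isUnit_iff_bijective.1 hU).2 v
    exact ⟨w, rfl⟩

/-! ### The path between two nearby projections -/

/-- The operator `((1 - t) P + t Q) P`. -/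
def pathOp (t : ℝ) (P Q : V₁ →L[𝕂] V₁) : V₁ →L[𝕂] V₁ :=
  ((1 - t : ℝ) : 𝕂) • P + (t : 𝕂) • (Q * P)

theorem pathOp_comp (hP : IsStarProjection P) (t : ℝ) : pathOp t P Q ∘L P = pathOp t P Q := by
  have h := hP.isIdempotentElem.eq
  change pathOp t P Q * P = _
  simp only [pathOp, add_mul, smul_mul_assoc, mul_assoc, h]

/-- For `v` in the range of `P`, pairing `pathOp t P Q v` with `v` gives `(1 - t)‖v‖² + t‖Q v‖²`. If
this is zero and `t < 1`, then `v = 0`; if `t = 1`, then `Q v = 0`, so `v` is killed by the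
intertwiner, which is invertible. -/
theorem isUnit_gram_pathOp [FiniteDimensional 𝕂 V₁] (hP : IsStarProjection P) (hQ : IsStarProjection Q)
    (h : IsUnit (intertwiner Q P)) {t : ℝ} (ht : t ∈ Set.Icc (0 : ℝ) 1) :
    IsUnit (gram (pathOp t P Q) P) := by
  refine isUnit_gram hP fun v hPv hv => ?_
  have h1 : inner 𝕂 (pathOp t P Q v) v = ((1 - t : ℝ) : 𝕂) * inner 𝕂 v v
      + (t : 𝕂) * inner 𝕂 (Q v) (Q v) := by
    rw [starProjection_inner_apply hQ, starProjection_apply_apply hQ,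
      ← starProjection_inner_apply hQ]
    simp [pathOp, inner_add_left, inner_smul_left, hPv]
  rw [hv, inner_zero_left, inner_self_eq_norm_sq_to_K, inner_self_eq_norm_sq_to_K] at h1
  have h2 : (0 : ℝ) = (1 - t) * ‖v‖ ^ 2 + t * ‖Q v‖ ^ 2 := by exact_mod_cast h1
  have h3 : 0 ≤ (1 - t) * ‖v‖ ^ 2 := mul_nonneg (by linarith [ht.2]) (sq_nonneg _)
  have h4 : 0 ≤ t * ‖Q v‖ ^ 2 := mul_nonneg ht.1 (sq_nonneg _)
  by_cases ht1 : t = 1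
  · subst ht1
    have h5 : Q v = 0 := by
      have : ‖Q v‖ ^ 2 = 0 := by linarith
      simpa using this
    refine eq_zero_of_isUnit h ?_
    simp [intertwiner, hPv, h5]
  · have h5 : (1 - t) * ‖v‖ ^ 2 = 0 := by linarith
    have h6 : 1 - t ≠ 0 := sub_ne_zero.2 (Ne.symm ht1)
    simpa [h6] using h5

/-- A path of projections from `P` to `Q`. -/
def pathProj (t : ℝ) (P Q : V₁ →L[𝕂] V₁) : V₁ →L[𝕂] V₁ := imageProj (pathOp t P Q) P

theorem pathProj_zero [FiniteDimensional 𝕂 V₁] (hP : IsStarProjection P) (hQ : IsStarProjection Q)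
    (h : IsUnit (intertwiner Q P)) : pathProj 0 P Q = P := by
  refine imageProj_eq hP (pathOp_comp hP 0)
    (isUnit_gram_pathOp hP hQ h ⟨le_rfl, zero_le_one⟩) hP ?_
  simp [pathOp]

theorem pathProj_one [FiniteDimensional 𝕂 V₁] (hP : IsStarProjection P) (hQ : IsStarProjection Q)
    (h : IsUnit (intertwiner Q P)) : pathProj 1 P Q = Q := by
  refine imageProj_eq hP (pathOp_comp hP 1)
    (isUnit_gram_pathOp hP hQ h ⟨zero_le_one, le_rfl⟩) hQ ?_
  -- At `t = 1` the operator is `Q P`, and the intertwiner carries the range of `P` onto that of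
  -- `Q`.
  have : pathOp 1 P Q = intertwiner Q P ∘L P := by
    change _ = intertwiner Q P * P
    rw [intertwiner_mul hP]
    simp [pathOp]
  rw [this, range_comp_of_mul_eq h (intertwiner_mul_eq hQ hP)]

theorem continuous_pathOp {Y : Type*} [TopologicalSpace Y] {t : Y → ℝ} {P Q : Y → V₁ →L[𝕂] V₁}
    (ht : Continuous t) (hP : Continuous P) (hQ : Continuous Q) :
    Continuous fun y => pathOp (t y) (P y) (Q y) := by
  have h1 : Continuous fun y => ((1 - t y : ℝ) : 𝕂) :=
    RCLike.continuous_ofReal.comp (continuous_const.sub ht)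
  have h2 : Continuous fun y => (t y : 𝕂) := RCLike.continuous_ofReal.comp ht
  exact (h1.smul hP).add (h2.smul (hQ.mul hP))

theorem continuous_pathProj [FiniteDimensional 𝕂 V₁] {Y : Type*} [TopologicalSpace Y]
    {t : Y → ℝ} {P Q : Y → V₁ →L[𝕂] V₁} (ht : Continuous t) (hP : Continuous P)
    (hQ : Continuous Q) (ht' : ∀ y, t y ∈ Set.Icc (0 : ℝ) 1) (hP' : ∀ y, IsStarProjection (P y))
    (hQ' : ∀ y, IsStarProjection (Q y)) (h : ∀ y, IsUnit (intertwiner (Q y) (P y))) :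
    Continuous fun y => pathProj (t y) (P y) (Q y) :=
  continuous_imageProj (continuous_pathOp ht hP hQ) hP fun y =>
    isUnit_gram_pathOp (hP' y) (hQ' y) (h y) (ht' y)

theorem isStarProjection_pathProj [FiniteDimensional 𝕂 V₁] (hP : IsStarProjection P)
    (hQ : IsStarProjection Q) (h : IsUnit (intertwiner Q P)) {t : ℝ}
    (ht : t ∈ Set.Icc (0 : ℝ) 1) : IsStarProjection (pathProj t P Q) :=
  isStarProjection_imageProj hP (pathOp_comp hP t) (isUnit_gram_pathOp hP hQ h ht)

theorem finrank_range_pathProj [FiniteDimensional 𝕂 V₁] (hP : IsStarProjection P)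
    (hQ : IsStarProjection Q) (h : IsUnit (intertwiner Q P)) {t : ℝ}
    (ht : t ∈ Set.Icc (0 : ℝ) 1) :
    Module.finrank 𝕂 (pathProj t P Q).range = Module.finrank 𝕂 P.range :=
  finrank_range_imageProj hP (pathOp_comp hP t) (isUnit_gram_pathOp hP hQ h ht)

end Projections

/-! ### Regularity of the projection on an image -/

section RegularProjections

open ContinuousLinearMap

variable {𝕂 : Type*} [RCLike 𝕂] {p n : ℕ} {V : Type*} [AddCommGroup V] [Module ℝ V] {S : Set V}

theorem finiteDimensional_real_clm : FiniteDimensional ℝ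
    (EuclideanSpace 𝕂 (Fin p) →L[𝕂] EuclideanSpace 𝕂 (Fin n)) :=
  Module.Finite.trans 𝕂 _

theorem IsRegularMap.clm_comp {q : ℕ}
    {B : S → EuclideanSpace 𝕂 (Fin n) →L[𝕂] EuclideanSpace 𝕂 (Fin q)}
    {A : S → EuclideanSpace 𝕂 (Fin p) →L[𝕂] EuclideanSpace 𝕂 (Fin n)}
    (hB : IsRegularMap S B) (hA : IsRegularMap S A) : IsRegularMap S fun x => B x ∘L A x := by
  have := finiteDimensional_real_clm (𝕂 := 𝕂) (p := p) (n := n)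
  have := finiteDimensional_real_clm (𝕂 := 𝕂) (p := n) (n := q)
  exact IsRegularMap.bilin (LinearMap.mk₂ ℝ (fun (B : EuclideanSpace 𝕂 (Fin n) →L[𝕂]
    EuclideanSpace 𝕂 (Fin q)) (A : EuclideanSpace 𝕂 (Fin p) →L[𝕂] EuclideanSpace 𝕂 (Fin n)) =>
      B ∘L A) (fun _ _ _ => by ext; simp) (fun _ _ _ => by ext; simp)
      (fun _ _ _ => by ext; simp) (fun c B A => by
        ext1 v
        simp only [coe_comp, Function.comp_apply, FunLike.coe_smul, Pi.smul_apply]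
        rw [RCLike.real_smul_eq_coe_smul (K := 𝕂), map_smul,
          ← RCLike.real_smul_eq_coe_smul (K := 𝕂)])) hB hA

/-- The adjoint is conjugate linear over `𝕂`, hence linear over `ℝ`, and regularity refers only to
the real structure. -/
theorem IsRegularMap.adjoint
    {A : S → EuclideanSpace 𝕂 (Fin p) →L[𝕂] EuclideanSpace 𝕂 (Fin n)}
    (hA : IsRegularMap S A) : IsRegularMap S fun x => ContinuousLinearMap.adjoint (A x) :=
  hA.comp_linear
    { toFun := fun A => ContinuousLinearMap.adjoint A
      map_add' := fun A B => map_add _ A B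
      map_smul' := fun c A => by
        rw [RCLike.real_smul_eq_coe_smul (K := 𝕂), map_smulₛₗ, RCLike.conj_ofReal,
          ← RCLike.real_smul_eq_coe_smul (K := 𝕂)]
        rfl }

theorem IsRegularMap.imageProj
    {A : S → EuclideanSpace 𝕂 (Fin p) →L[𝕂] EuclideanSpace 𝕂 (Fin n)}
    {P : S → EuclideanSpace 𝕂 (Fin p) →L[𝕂] EuclideanSpace 𝕂 (Fin p)}
    (hA : IsRegularMap S A) (hP : IsRegularMap S P) (hu : ∀ x, IsUnit (gram (A x) (P x))) :
    IsRegularMap S fun x => StableAlg.imageProj (A x) (P x) := by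
  have := finiteDimensional_real_clm (𝕂 := 𝕂) (p := p) (n := p)
  have hg : IsRegularMap S fun x => gram (A x) (P x) :=
    (hA.adjoint.clm_comp hA).add ((isRegularMap_const 1).sub hP)
  exact hA.clm_comp ((hg.ringInverse hu).clm_comp hA.adjoint)

/-- With `t` fixed the coefficients `1 - t` and `t` are real constants. This is what keeps regular
maps regular throughout the deformation. -/
theorem IsRegularMap.pathProj {t : ℝ} (ht : t ∈ Set.Icc (0 : ℝ) 1)
    {P Q : S → EuclideanSpace 𝕂 (Fin p) →L[𝕂] EuclideanSpace 𝕂 (Fin p)}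
    (hP : IsRegularMap S P) (hQ : IsRegularMap S Q) (hP' : ∀ x, IsStarProjection (P x))
    (hQ' : ∀ x, IsStarProjection (Q x)) (h : ∀ x, IsUnit (intertwiner (Q x) (P x))) :
    IsRegularMap S fun x => StableAlg.pathProj t (P x) (Q x) := by
  refine IsRegularMap.imageProj ?_ hP fun x => isUnit_gram_pathOp (hP' x) (hQ' x) (h x) ht
  simp only [pathOp, ← RCLike.real_smul_eq_coe_smul (K := 𝕂)]
  exact (hP.const_smul (1 - t)).add ((hQ.clm_comp hP).const_smul t)

end RegularProjections

end

end StableAlg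

namespace StableAlg

noncomputable section

/-! ### Approximation by families of regular maps -/

section Approximation

open scoped unitInterval

variable {D : Type*} [TopologicalSpace D] [CompactSpace D] [T2Space D] {m : ℕ}
  {X : Set (Fin m → ℝ)}

/-- The algebra of families of regular functions. -/
def regularFamilies (D : Type*) [TopologicalSpace D] (X : Set (Fin m → ℝ)) :
    Subalgebra ℝ C(D × X, ℝ) where
  carrier := {h | ∀ s, IsRegularFun X fun x => h (s, x)}
  mul_mem' hf hg s := (regularFunctions X).mul_mem (hf s) (hg s)
  add_mem' hf hg s := (regularFunctions X).add_mem (hf s) (hg s)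
  algebraMap_mem' r _ := (isPolynomialFun_const r).isRegularFun

/-- Stone–Weierstrass on `D × X`. Different parameters are separated by a Urysohn function of `s`
alone, which is constant in `x` and so regular; points over the same parameter are separated by a
coordinate of `x`. -/
theorem dense_regularFamilies [CompactSpace X] :
    Dense (regularFamilies D X : Set C(D × X, ℝ)) := by
  have hsep : (regularFamilies D X).SeparatesPoints := by
    rintro ⟨s, x⟩ ⟨s', x'⟩ h
    by_cases hs : s = s'
    · have hx : (x : Fin m → ℝ) ≠ x' := fun hx => h (by rw [hs, Subtype.ext hx])
      obtain ⟨i, hi⟩ := Function.ne_iff.1 hx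
      refine ⟨_, ⟨⟨fun y : D × X => (y.2 : Fin m → ℝ) i, ?_⟩, fun _ => ?_, rfl⟩, hi⟩
      · exact (continuous_apply i).comp (continuous_subtype_val.comp continuous_snd)
      · exact (isPolynomialFun_dual
          (LinearMap.proj i : (Fin m → ℝ) →ₗ[ℝ] ℝ)).isRegularFun
    · obtain ⟨f, hf0, hf1, -⟩ := exists_continuous_zero_one_of_isClosed
        (isClosed_singleton (x := s)) (isClosed_singleton (x := s')) (by simpa using hs)
      refine ⟨_, ⟨f.comp ContinuousMap.fst, fun t =>
        (isPolynomialFun_const (f t)).isRegularFun, rfl⟩, ?_⟩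
      have h0 : f s = 0 := hf0 rfl
      have h1 : f s' = 1 := hf1 rfl
      simp [h0, h1]
  have h := ContinuousMap.subalgebra_topologicalClosure_eq_top_of_separatesPoints _ hsep
  rw [dense_iff_closure_eq, ← Subalgebra.topologicalClosure_coe, h]
  rfl

/-- Stone–Weierstrass for families of maps to a finite-dimensional space. -/
theorem dense_regularMap_families [CompactSpace X] {W : Type*} [NormedAddCommGroup W]
    [NormedSpace ℝ W] [FiniteDimensional ℝ W] :
    Dense {h : C(D × X, W) | ∀ s, IsRegularMap X fun x => h (s, x)} := by
  let b := Module.finBasis ℝ W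
  let Ψ : (Fin (Module.finrank ℝ W) → C(D × X, ℝ)) → C(D × X, W) := fun h =>
    ⟨fun y => ∑ i, h i y • b i, by fun_prop⟩
  have hΨ : Continuous Ψ := by
    refine ContinuousMap.continuous_of_continuous_uncurry _ ?_
    change Continuous fun z : (Fin (Module.finrank ℝ W) → C(D × X, ℝ)) × (D × X) =>
      ∑ i, z.1 i z.2 • b i
    refine continuous_finsetSum _ fun i _ => Continuous.smul ?_ continuous_const
    exact (((continuous_apply i).comp continuous_fst :
      Continuous fun z : (Fin (Module.finrank ℝ W) → C(D × X, ℝ)) × (D × X) => z.1 i)).eval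
      continuous_snd
  have hsurj : Function.Surjective Ψ := by
    intro h
    refine ⟨fun i => ⟨fun y => b.repr (h y) i, ?_⟩, ?_⟩
    · exact (b.coord i).continuous_of_finiteDimensional.comp h.continuous
    · ext y
      exact b.sum_repr (h y)
  have hd := dense_pi (Set.univ : Set (Fin (Module.finrank ℝ W)))
    fun _ _ => dense_regularFamilies (D := D) (X := X)
  refine (hsurj.denseRange.dense_image hΨ hd).mono ?_
  rintro _ ⟨h, hh, rfl⟩ s
  refine (isRegularMap_iff_basis b).2 fun i => ?_
  have := hh i trivial s
  convert this using 2 with x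
  simp only [Ψ, ContinuousMap.coe_mk, b.repr_sum_self]

variable {𝕂 : Type*} [RCLike 𝕂] {p n : ℕ}

/-- The passage from `f` to its graph `y ↦ (y, f y)` is continuous, and mapping the compact space
`Y` into `O` is an open condition in the compact-open topology. -/
theorem isOpen_setOf_forall_mem {Y Z : Type*} [TopologicalSpace Y] [CompactSpace Y]
    [LocallyCompactSpace Y] [TopologicalSpace Z] {O : Set (Y × Z)} (hO : IsOpen O) :
    IsOpen {f : C(Y, Z) | ∀ y, (y, f y) ∈ O} := by
  let G : C(Y, Z) → C(Y, Y × Z) := fun f => (ContinuousMap.id Y).prodMk f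
  have hG : Continuous G := by
    refine ContinuousMap.continuous_of_continuous_uncurry _ ?_
    exact continuous_snd.prodMk (continuous_fst.eval continuous_snd)
  convert (ContinuousMap.isOpen_setOfPred_mapsTo (isCompact_univ (X := Y)) hO).preimage hG
    using 1
  ext f
  simp [G, Set.MapsTo]

/-- A continuous family of subbundles, each of which is isomorphic to the image of a regular
projection `E`, can be approximated by a continuous family of regular projections. -/
theorem exists_regular_family [CompactSpace X]
    {E : X → EuclideanSpace 𝕂 (Fin p) →L[𝕂] EuclideanSpace 𝕂 (Fin p)}
    (hE : IsRegularMap X E) (hEp : ∀ x, IsStarProjection (E x))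
    (P : C(D × X, EuclideanSpace 𝕂 (Fin n) →L[𝕂] EuclideanSpace 𝕂 (Fin n)))
    (hP : ∀ y, IsStarProjection (P y))
    (Φ : C(D × X, EuclideanSpace 𝕂 (Fin p) →L[𝕂] EuclideanSpace 𝕂 (Fin n)))
    (hinj : ∀ y v, E y.2 v = v → Φ y v = 0 → v = 0)
    (hrange : ∀ y, (Φ y ∘L E y.2).range = (P y).range) :
    ∃ R : C(D × X, EuclideanSpace 𝕂 (Fin n) →L[𝕂] EuclideanSpace 𝕂 (Fin n)),
      (∀ y, IsStarProjection (R y)) ∧ (∀ y, IsUnit (intertwiner (R y) (P y))) ∧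
      (∀ y, Module.finrank 𝕂 (R y).range = Module.finrank 𝕂 (P y).range) ∧
      ∀ s, IsRegularMap X fun x => R (s, x) := by
  have := finiteDimensional_real_clm (𝕂 := 𝕂) (p := p) (n := p)
  have := finiteDimensional_real_clm (𝕂 := 𝕂) (p := p) (n := n)
  let Hom := EuclideanSpace 𝕂 (Fin p) →L[𝕂] EuclideanSpace 𝕂 (Fin n)
  have hEc : Continuous E := hE.continuous
  have hcomp (y : D × X) (Q : Hom) : (Q ∘L E y.2) ∘L E y.2 = Q ∘L E y.2 := by
    rw [ContinuousLinearMap.comp_assoc]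
    congr 1
    exact (hEp y.2).isIdempotentElem.eq
  -- `O₁` is where the image projection is given by a true inverse. Elsewhere `Ring.inverse` takes
  -- the value `0`, so `g` below is only claimed to be continuous on `O₁`.
  let O₁ : Set ((D × X) × Hom) := {z | IsUnit (gram (z.2 ∘L E z.1.2) (E z.1.2))}
  have hA : Continuous fun z : (D × X) × Hom => z.2 ∘L E z.1.2 := by fun_prop
  have hE' : Continuous fun z : (D × X) × Hom => E z.1.2 := by fun_prop
  have hO₁ : IsOpen O₁ := Units.isOpen.preimage (continuous_gram hA hE')
  let g : (D × X) × Hom → EuclideanSpace 𝕂 (Fin n) →L[𝕂] EuclideanSpace 𝕂 (Fin n) :=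
    fun z => intertwiner (imageProj (z.2 ∘L E z.1.2) (E z.1.2)) (P z.1)
  have hg : ContinuousOn g O₁ := by
    rw [continuousOn_iff_continuous_domRestrict]
    refine continuous_intertwiner ?_ (by fun_prop)
    exact continuous_imageProj (hA.comp continuous_subtype_val)
      (hE'.comp continuous_subtype_val) fun z => z.2
  have hO : IsOpen (O₁ ∩ g ⁻¹' {a | IsUnit a}) := hg.isOpen_inter_preimage hO₁ Units.isOpen
  -- For `Φ` itself the image projection is exactly `P`, and the intertwiner is `1`.
  have hΦ : Φ ∈ {f : C(D × X, Hom) | ∀ y, (y, f y) ∈ O₁ ∩ g ⁻¹' {a | IsUnit a}} := by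
    intro y
    have h1 : IsUnit (gram (Φ y ∘L E y.2) (E y.2)) := by
      refine isUnit_gram (hEp y.2) fun v hv hv' => hinj y v hv ?_
      simpa [hv] using hv'
    refine ⟨h1, ?_⟩
    change IsUnit (intertwiner (imageProj (Φ y ∘L E y.2) (E y.2)) (P y))
    rw [imageProj_eq (hEp y.2) (hcomp y _) h1 (hP y) (hrange y).symm, intertwiner_self (hP y)]
    exact isUnit_one
  obtain ⟨Q, hQO, hQ⟩ := (dense_regularMap_families (D := D) (X := X) (W := Hom)).inter_open_nonempty
    _ (isOpen_setOf_forall_mem hO) ⟨Φ, hΦ⟩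
  have hu (y : D × X) : IsUnit (gram (Q y ∘L E y.2) (E y.2)) := (hQO y).1
  refine ⟨⟨fun y => imageProj (Q y ∘L E y.2) (E y.2), ?_⟩, fun y => ?_, fun y => ?_, fun y => ?_,
    fun s => ?_⟩
  · exact continuous_imageProj (by fun_prop) (by fun_prop) hu
  · exact isStarProjection_imageProj (hEp y.2) (hcomp y _) (hu y)
  · exact (hQO y).2
  -- Both ranks equal the rank of `E y.2`.
  · have h1 : IsUnit (gram (Φ y ∘L E y.2) (E y.2)) := (hΦ y).1
    rw [← hrange y, ← range_imageProj (hEp y.2) (hcomp y _) h1,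
      finrank_range_imageProj (hEp y.2) (hcomp y _) h1]
    exact finrank_range_imageProj (hEp y.2) (hcomp y _) (hu y)
  · exact ((hQ s).clm_comp hE).imageProj hE fun x => hu (s, x)

/-- The ends of a homotopy of projections are conjugate. -/
theorem exists_continuous_conj {K : Type*} [TopologicalSpace K] [CompactSpace K]
    {V : Type*} [NormedAddCommGroup V] [InnerProductSpace 𝕂 V] [CompleteSpace V]
    (P : C(I × K, V →L[𝕂] V)) (hP : ∀ y, IsStarProjection (P y)) :
    ∃ U : C(K, V →L[𝕂] V), ∀ y, IsUnit (U y) ∧ U y * P (0, y) = P (1, y) * U y := by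
  let r : I → I → Prop := fun t t' =>
    ∃ U : C(K, V →L[𝕂] V), ∀ y, IsUnit (U y) ∧ U y * P (t, y) = P (t', y) * U y
  have hsymm : Std.Symm r := ⟨by
    rintro t t' ⟨U, hU⟩
    refine ⟨⟨fun y => Ring.inverse (U y), continuous_ringInverse U.continuous fun y => (hU y).1⟩,
      fun y => ⟨(hU y).1.ringInverse, ?_⟩⟩
    have h1 := Ring.inverse_mul_cancel _ (hU y).1
    have h2 := Ring.mul_inverse_cancel _ (hU y).1
    change Ring.inverse (U y) * P (t', y) = P (t, y) * Ring.inverse (U y)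
    calc Ring.inverse (U y) * P (t', y)
        = Ring.inverse (U y) * P (t', y) * (U y * Ring.inverse (U y)) := by rw [h2, mul_one]
      _ = Ring.inverse (U y) * (P (t', y) * U y) * Ring.inverse (U y) := by
          simp only [mul_assoc]
      _ = (Ring.inverse (U y) * U y) * P (t, y) * Ring.inverse (U y) := by
          rw [← (hU y).2]
          simp only [mul_assoc]
      _ = P (t, y) * Ring.inverse (U y) := by rw [h1, one_mul]⟩
  -- Conjugacy is symmetric and transitive, so on the connected interval it need only be checked for
  -- `t'` near `t`. There the intertwiner conjugates, and compactness of `K` makes the neighbourhood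
  -- of `t` uniform in `y`.
  refine PreconnectedSpace.induction₂ r (fun t => ?_) ⟨?_⟩ 0 1
  · have hc : Continuous fun z : I × K => intertwiner (P z) (P (t, z.2)) :=
      continuous_intertwiner (by fun_prop) (by fun_prop)
    have : ∀ᶠ t' in 𝓝 t, ∀ y ∈ (Set.univ : Set K), IsUnit (intertwiner (P (t', y)) (P (t, y))) := by
      refine isCompact_univ.eventually_forall_of_forall_eventually fun y _ => ?_
      refine (Units.isOpen.preimage hc).mem_nhds ?_
      change IsUnit (intertwiner (P (t, y)) (P (t, y)))
      rw [intertwiner_self (hP _)]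
      exact isUnit_one
    filter_upwards [this] with t' ht'
    refine ⟨⟨fun y => intertwiner (P (t', y)) (P (t, y)),
      continuous_intertwiner (by fun_prop) (by fun_prop)⟩, fun y => ⟨ht' y trivial, ?_⟩⟩
    exact intertwiner_mul_eq (hP _) (hP _)
  · rintro t t' t'' ⟨U, hU⟩ ⟨U', hU'⟩
    refine ⟨U' * U, fun y => ⟨(hU' y).1.mul (hU y).1, ?_⟩⟩
    rw [ContinuousMap.mul_apply, mul_assoc, (hU y).2, ← mul_assoc, (hU' y).2, mul_assoc]

end Approximation

end

end StableAlg

namespace StableAlg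

noncomputable section

/-! ### The Grassmannian and projections -/

section GrassmannianBasics

variable {𝕂 : Type*} [RCLike 𝕂] {n k : ℕ}

theorem Grassmannian.continuous_proj :
    Continuous (Grassmannian.proj : Grassmannian 𝕂 n k → _) :=
  continuous_induced_dom

theorem Grassmannian.isStarProjection_proj (L : Grassmannian 𝕂 n k) : IsStarProjection L.proj :=
  isStarProjection_starProjection

theorem Grassmannian.range_proj (L : Grassmannian 𝕂 n k) : L.proj.range = L.1 :=
  Submodule.range_starProjection L.1

theorem Grassmannian.finrank_range_proj (L : Grassmannian 𝕂 n k) :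
    Module.finrank 𝕂 L.proj.range = k := by
  rw [L.range_proj]
  exact L.2

theorem Grassmannian.proj_apply_of_mem {L : Grassmannian 𝕂 n k}
    {v : EuclideanSpace 𝕂 (Fin n)} (hv : v ∈ L.1) : L.proj v = v :=
  Submodule.starProjection_eq_self_iff.2 hv

theorem Grassmannian.proj_apply_mem (L : Grassmannian 𝕂 n k)
    (v : EuclideanSpace 𝕂 (Fin n)) : L.proj v ∈ L.1 :=
  Submodule.starProjection_apply_mem _ v

/-- The point of the Grassmannian given by an orthogonal projection. -/
def Grassmannian.ofProj (P : EuclideanSpace 𝕂 (Fin n) →L[𝕂] EuclideanSpace 𝕂 (Fin n))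
    (hk : Module.finrank 𝕂 P.range = k) : Grassmannian 𝕂 n k := ⟨P.range, hk⟩

theorem Grassmannian.proj_ofProj
    {P : EuclideanSpace 𝕂 (Fin n) →L[𝕂] EuclideanSpace 𝕂 (Fin n)}
    (hP : IsStarProjection P) (hk : Module.finrank 𝕂 P.range = k) :
    (Grassmannian.ofProj P hk).proj = P :=
  ContinuousLinearMap.IsStarProjection.ext (Grassmannian.isStarProjection_proj _) hP
    (Grassmannian.range_proj _)

theorem Grassmannian.proj_injective :
    Function.Injective (Grassmannian.proj : Grassmannian 𝕂 n k → _) := by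
  intro L L' h
  have := congrArg (fun P : EuclideanSpace 𝕂 (Fin n) →L[𝕂] EuclideanSpace 𝕂 (Fin n) => P.range) h
  simp only [Grassmannian.range_proj] at this
  exact Subtype.ext this

theorem Grassmannian.continuous_ofProj {Y : Type*} [TopologicalSpace Y]
    {P : Y → EuclideanSpace 𝕂 (Fin n) →L[𝕂] EuclideanSpace 𝕂 (Fin n)} (hP : Continuous P)
    (hP' : ∀ y, IsStarProjection (P y)) (hk : ∀ y, Module.finrank 𝕂 (P y).range = k) :
    Continuous fun y => Grassmannian.ofProj (P y) (hk y) := by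
  refine continuous_induced_rng.2 ?_
  convert hP using 1
  ext1 y
  exact Grassmannian.proj_ofProj (hP' y) (hk y)

end GrassmannianBasics

/-! ### The pull-back of the tautological bundle -/

section TautologicalBundle

variable {𝕂 : Type*} [RCLike 𝕂] {n k : ℕ} {B : Type*} [TopologicalSpace B]

/-- The fibres of the pull-back of the tautological bundle. -/
def TautFiber (f : C(B, Grassmannian 𝕂 n k)) (x : B) : Type _ := (f x).1

variable (f : C(B, Grassmannian 𝕂 n k))

instance (x : B) : AddCommGroup (TautFiber f x) := inferInstanceAs (AddCommGroup (f x).1)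

instance (x : B) : Module 𝕂 (TautFiber f x) := inferInstanceAs (Module 𝕂 (f x).1)

instance (x : B) : TopologicalSpace (TautFiber f x) := inferInstanceAs (TopologicalSpace (f x).1)

/-- The inclusion of a fibre in the ambient space. -/
def TautFiber.incl {f : C(B, Grassmannian 𝕂 n k)} {x : B} :
    TautFiber f x →ₗ[𝕂] EuclideanSpace 𝕂 (Fin n) := (f x).1.subtype

theorem TautFiber.incl_mem {x : B} (v : TautFiber f x) : v.incl ∈ (f x).1 := v.2

theorem TautFiber.proj_incl {x : B} (v : TautFiber f x) : (f x).proj v.incl = v.incl :=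
  Grassmannian.proj_apply_of_mem v.2

/-- The projection on a fibre, as an element of the fibre. -/
def TautFiber.mk (x : B) (v : EuclideanSpace 𝕂 (Fin n)) : TautFiber f x :=
  ⟨(f x).proj v, (f x).proj_apply_mem v⟩

theorem TautFiber.incl_mk (x : B) (v : EuclideanSpace 𝕂 (Fin n)) :
    (TautFiber.mk f x v).incl = (f x).proj v := rfl

theorem TautFiber.incl_injective {x : B} :
    Function.Injective (TautFiber.incl (f := f) (x := x)) := Subtype.val_injective

/-- The map from the total space to `B × 𝕂^n`. -/
def tautEmb (e : TotalSpace (Fin k → 𝕂) (TautFiber f)) : B × EuclideanSpace 𝕂 (Fin n) :=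
  (e.1, e.2.incl)

instance : TopologicalSpace (TotalSpace (Fin k → 𝕂) (TautFiber f)) :=
  TopologicalSpace.induced (tautEmb f) inferInstance

theorem continuous_tautEmb : Continuous (tautEmb f) := continuous_induced_dom

theorem continuous_proj_comp : Continuous fun x => (f x).proj :=
  Grassmannian.continuous_proj.comp f.continuous

/-- A frame of the fibre at `x₀`. -/
def tautFrame (x₀ : B) : (f x₀).1 ≃L[𝕂] (Fin k → 𝕂) :=
  (LinearEquiv.ofFinrankEq _ _ (by rw [(f x₀).2]; simp)).toContinuousLinearEquiv

/-- Coordinates with respect to the frame at `x₀`. -/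
def tautCoord (x₀ : B) : EuclideanSpace 𝕂 (Fin n) →L[𝕂] (Fin k → 𝕂) :=
  (tautFrame f x₀ : (f x₀).1 →L[𝕂] (Fin k → 𝕂)) ∘L (f x₀).1.orthogonalProjectionOnto

/-- The vector with given coordinates with respect to the frame at `x₀`. -/
def tautVec (x₀ : B) : (Fin k → 𝕂) →L[𝕂] EuclideanSpace 𝕂 (Fin n) :=
  (f x₀).1.subtypeL ∘L ((tautFrame f x₀).symm : (Fin k → 𝕂) →L[𝕂] (f x₀).1)

theorem tautVec_tautCoord (x₀ : B) (v : EuclideanSpace 𝕂 (Fin n)) :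
    tautVec f x₀ (tautCoord f x₀ v) = (f x₀).proj v := by
  simp [tautVec, tautCoord, Grassmannian.proj]

theorem tautCoord_tautVec (x₀ : B) (v : Fin k → 𝕂) :
    tautCoord f x₀ (tautVec f x₀ v) = v := by
  simp [tautVec, tautCoord]

theorem proj_tautVec (x₀ : B) (v : Fin k → 𝕂) :
    (f x₀).proj (tautVec f x₀ v) = tautVec f x₀ v := by
  rw [← tautVec_tautCoord, tautCoord_tautVec]

theorem tautCoord_proj (x₀ : B) (v : EuclideanSpace 𝕂 (Fin n)) :
    tautCoord f x₀ ((f x₀).proj v) = tautCoord f x₀ v := by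
  rw [← tautVec_tautCoord, tautCoord_tautVec]

/-- The transition operator from `x` to `x₀`. -/
def tautTrans (x₀ x : B) : EuclideanSpace 𝕂 (Fin n) →L[𝕂] EuclideanSpace 𝕂 (Fin n) :=
  intertwiner (f x₀).proj (f x).proj

theorem continuous_tautTrans (x₀ : B) : Continuous (tautTrans f x₀) :=
  continuous_intertwiner continuous_const (continuous_proj_comp f)

/-- The domain of the trivialization at `x₀`. -/
def tautBase (x₀ : B) : Set B := {x | IsUnit (tautTrans f x₀ x)}

theorem isOpen_tautBase (x₀ : B) : IsOpen (tautBase f x₀) :=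
  Units.isOpen.preimage (continuous_tautTrans f x₀)

theorem mem_tautBase (x₀ : B) : x₀ ∈ tautBase f x₀ := by
  change IsUnit (intertwiner _ _)
  rw [intertwiner_self (f x₀).isStarProjection_proj]
  exact isUnit_one

theorem tautTrans_apply {x₀ x : B} {v : EuclideanSpace 𝕂 (Fin n)} (hv : (f x).proj v = v) :
    tautTrans f x₀ x v = (f x₀).proj v := by
  simp [tautTrans, intertwiner, hv]

variable {f} in
theorem inverse_tautTrans_apply {x₀ x : B} (hx : x ∈ tautBase f x₀)
    (v : EuclideanSpace 𝕂 (Fin n)) :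
    Ring.inverse (tautTrans f x₀ x) (tautTrans f x₀ x v) = v :=
  congrArg (fun T : EuclideanSpace 𝕂 (Fin n) →L[𝕂] EuclideanSpace 𝕂 (Fin n) => T v)
    (Ring.inverse_mul_cancel _ hx)

variable {f} in
theorem tautTrans_inverse_apply {x₀ x : B} (hx : x ∈ tautBase f x₀)
    (v : EuclideanSpace 𝕂 (Fin n)) :
    tautTrans f x₀ x (Ring.inverse (tautTrans f x₀ x) v) = v :=
  congrArg (fun T : EuclideanSpace 𝕂 (Fin n) →L[𝕂] EuclideanSpace 𝕂 (Fin n) => T v)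
    (Ring.mul_inverse_cancel _ hx)

/-- The operator inverse to the coordinates at `x₀` on the fibre at `x`. -/
def tautInv (x₀ x : B) : (Fin k → 𝕂) →L[𝕂] EuclideanSpace 𝕂 (Fin n) :=
  (f x).proj ∘L Ring.inverse (tautTrans f x₀ x) ∘L tautVec f x₀

theorem continuousOn_tautInv (x₀ : B) : ContinuousOn (tautInv f x₀) (tautBase f x₀) := by
  rw [continuousOn_iff_continuous_domRestrict]
  refine ((continuous_proj_comp f).comp continuous_subtype_val).clm_comp (Continuous.clm_comp ?_
    continuous_const)
  exact continuous_ringInverse ((continuous_tautTrans f x₀).comp continuous_subtype_val)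
    fun x => x.2

variable {f} in
theorem tautInv_tautCoord {x₀ x : B} (hx : x ∈ tautBase f x₀) {v : EuclideanSpace 𝕂 (Fin n)}
    (hv : (f x).proj v = v) : tautInv f x₀ x (tautCoord f x₀ v) = v := by
  simp only [tautInv, ContinuousLinearMap.coe_comp, Function.comp_apply]
  rw [tautVec_tautCoord, ← tautTrans_apply f hv, inverse_tautTrans_apply hx, hv]

variable {f} in
-- By the conjugation relation, the transition operator sends the projected vector `tautInv f x₀ x
-- v` to `tautVec f x₀ v`; on the fibre at `x` that operator is the projection at `x₀`.
theorem tautCoord_tautInv {x₀ x : B} (hx : x ∈ tautBase f x₀) (v : Fin k → 𝕂) :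
    tautCoord f x₀ (tautInv f x₀ x v) = v := by
  have h1 := congrArg (fun T : EuclideanSpace 𝕂 (Fin n) →L[𝕂] EuclideanSpace 𝕂 (Fin n) =>
    T (Ring.inverse (tautTrans f x₀ x) (tautVec f x₀ v)))
    (intertwiner_mul_eq (f x₀).isStarProjection_proj (f x).isStarProjection_proj)
  change tautTrans f x₀ x ((f x).proj _) = (f x₀).proj (tautTrans f x₀ x _) at h1
  rw [tautTrans_inverse_apply hx, proj_tautVec, tautTrans_apply f
    (starProjection_apply_apply (f x).isStarProjection_proj _)] at h1
  rw [← tautCoord_proj]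
  simp only [tautInv, ContinuousLinearMap.coe_comp, Function.comp_apply]
  rw [h1, tautCoord_tautVec]

/-- The coordinate map of the trivialization near `x₀`. -/
def tautToFun (x₀ : B) (e : TotalSpace (Fin k → 𝕂) (TautFiber f)) : B × (Fin k → 𝕂) :=
  (e.1, tautCoord f x₀ e.2.incl)

/-- The inverse of the coordinate map of the trivialization near `x₀`. -/
def tautInvFun (x₀ : B) (y : B × (Fin k → 𝕂)) : TotalSpace (Fin k → 𝕂) (TautFiber f) :=
  ⟨y.1, TautFiber.mk f y.1 (tautInv f x₀ y.1 y.2)⟩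

theorem proj_tautInv (x₀ x : B) (v : Fin k → 𝕂) :
    (f x).proj (tautInv f x₀ x v) = tautInv f x₀ x v :=
  starProjection_apply_apply (f x).isStarProjection_proj _

theorem tautEmb_tautInvFun (x₀ : B) (y : B × (Fin k → 𝕂)) :
    tautEmb f (tautInvFun f x₀ y) = (y.1, tautInv f x₀ y.1 y.2) :=
  Prod.ext rfl (proj_tautInv f x₀ y.1 y.2)

theorem continuous_tautToFun (x₀ : B) : Continuous (tautToFun f x₀) :=
  (continuous_fst.comp (continuous_tautEmb f)).prodMk
    ((tautCoord f x₀).continuous.comp (continuous_snd.comp (continuous_tautEmb f)))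

theorem continuousOn_tautInvFun (x₀ : B) :
    ContinuousOn (tautInvFun f x₀) (tautBase f x₀ ×ˢ Set.univ) := by
  rw [(IsInducing.induced (tautEmb f)).continuousOn_iff]
  have h : tautEmb f ∘ tautInvFun f x₀ = fun y => (y.1, tautInv f x₀ y.1 y.2) :=
    funext (tautEmb_tautInvFun f x₀)
  rw [h]
  refine continuousOn_fst.prodMk (ContinuousOn.clm_apply ?_ continuousOn_snd)
  exact (continuousOn_tautInv f x₀).comp continuousOn_fst fun y hy => hy.1

theorem tautInvFun_tautToFun (x₀ : B) {e : TotalSpace (Fin k → 𝕂) (TautFiber f)}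
    (he : e.1 ∈ tautBase f x₀) : tautInvFun f x₀ (tautToFun f x₀ e) = e := by
  obtain ⟨x, v⟩ := e
  refine congrArg (TotalSpace.mk x) (TautFiber.incl_injective f ?_)
  rw [TautFiber.incl_mk]
  change (f x).proj (tautInv f x₀ x (tautCoord f x₀ v.incl)) = v.incl
  rw [tautInv_tautCoord he (TautFiber.proj_incl f v), TautFiber.proj_incl]

theorem tautToFun_tautInvFun (x₀ : B) {y : B × (Fin k → 𝕂)} (hy : y.1 ∈ tautBase f x₀) :
    tautToFun f x₀ (tautInvFun f x₀ y) = y := by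
  obtain ⟨x, v⟩ := y
  refine Prod.ext rfl ?_
  change tautCoord f x₀ ((f x).proj (tautInv f x₀ x v)) = v
  rw [proj_tautInv, tautCoord_tautInv hy]

/-- The trivialization of the tautological bundle near `x₀`. -/
def tautTriv (x₀ : B) : Trivialization (Fin k → 𝕂) (π (Fin k → 𝕂) (TautFiber f)) where
  toFun := tautToFun f x₀
  invFun := tautInvFun f x₀
  source := π (Fin k → 𝕂) (TautFiber f) ⁻¹' tautBase f x₀
  target := tautBase f x₀ ×ˢ Set.univ
  map_source' _ he := ⟨he, trivial⟩
  map_target' _ hy := hy.1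
  left_inv' _ he := tautInvFun_tautToFun f x₀ he
  right_inv' _ hy := tautToFun_tautInvFun f x₀ hy.1
  open_source := (isOpen_tautBase f x₀).preimage (continuous_fst.comp (continuous_tautEmb f))
  open_target := (isOpen_tautBase f x₀).prod isOpen_univ
  continuousOn_toFun := (continuous_tautToFun f x₀).continuousOn
  continuousOn_invFun := continuousOn_tautInvFun f x₀
  baseSet := tautBase f x₀
  open_baseSet := isOpen_tautBase f x₀
  source_eq := rfl
  target_eq := rfl
  proj_toFun _ _ := rfl

instance : FiberBundle (Fin k → 𝕂) (TautFiber f) where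
  totalSpaceMk_isInducing' b := by
    have h : IsInducing (tautEmb f ∘ TotalSpace.mk b) := by
      have h1 : IsInducing fun v : TautFiber f b => (v.incl : EuclideanSpace 𝕂 (Fin n)) :=
        IsInducing.subtypeVal
      exact (isInducing_const_prod (x := b)).2 h1
    exact ((IsInducing.induced (tautEmb f)).of_comp_iff).1 h
  trivializationAtlas' := Set.range (tautTriv f)
  trivializationAt' := tautTriv f
  mem_baseSet_trivializationAt' := mem_tautBase f
  trivialization_mem_atlas' x := ⟨x, rfl⟩

instance tautTriv_isLinear (x₀ : B) : (tautTriv f x₀).IsLinear 𝕂 where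
  linear _ _ := ⟨fun v w => by
    change tautCoord f x₀ (TautFiber.incl (v + w)) = _
    rw [map_add, map_add]
    rfl, fun c v => by
    change tautCoord f x₀ (TautFiber.incl (c • v)) = _
    rw [map_smul, map_smul]
    rfl⟩

instance : VectorBundle 𝕂 (Fin k → 𝕂) (TautFiber f) where
  trivialization_linear' := by
    rintro _ ⟨x₀, rfl⟩
    exact tautTriv_isLinear f x₀
  continuousOn_coordChange' := by
    rintro _ _ ⟨x₀, rfl⟩ ⟨x₁, rfl⟩
    -- These composites are the coordinate changes, continuous in the operator norm.
    have h : ContinuousOn (fun b => tautCoord f x₁ ∘L tautInv f x₀ b)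
        (tautBase f x₀ ∩ tautBase f x₁) :=
      continuousOn_const.clm_comp ((continuousOn_tautInv f x₀).mono Set.inter_subset_left)
    refine h.congr fun b hb => ?_
    ext1 v
    have h1 := (tautTriv f x₀).apply_symm_apply_eq_coordChangeL (R := 𝕂) (tautTriv f x₁) hb v
    have h2 := congrArg Prod.snd h1
    refine h2.symm.trans ?_
    change tautCoord f x₁ ((f b).proj (tautInv f x₀ b v)) = tautCoord f x₁ (tautInv f x₀ b v)
    rw [proj_tautInv]

end TautologicalBundle

end

end StableAlg

namespace StableAlg

noncomputable section

/-! ### Algebraic vector bundles and regular projections -/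

section AlgebraicBundles

theorem IsRegularMap.sum {V W : Type*} [AddCommGroup V] [Module ℝ V] [AddCommGroup W] [Module ℝ W]
    {S : Set V} {ι : Type*} (s : Finset ι) {f : ι → S → W} (hf : ∀ i, IsRegularMap S (f i)) :
    IsRegularMap S fun x => ∑ i ∈ s, f i x := by
  classical
  induction s using Finset.induction_on with
  | empty => simpa using isRegularMap_const (0 : W)
  | insert i s hi ih =>
    simp only [Finset.sum_insert hi]
    exact (hf i).add ih

variable {𝕂 : Type*} [RCLike 𝕂] {k m : ℕ} {X : Set (Fin m → ℝ)}

/-- A family of operators is regular if its columns are. -/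
theorem isRegularMap_of_columns {V : Type*} [AddCommGroup V] [Module ℝ V] {S : Set V} {k p : ℕ}
    {A : S → EuclideanSpace 𝕂 (Fin k) →L[𝕂] EuclideanSpace 𝕂 (Fin p)}
    (hA : ∀ j, IsRegularMap S fun x => A x (EuclideanSpace.single j 1)) : IsRegularMap S A := by
  let L (j : Fin k) : EuclideanSpace 𝕂 (Fin p) →ₗ[ℝ]
      (EuclideanSpace 𝕂 (Fin k) →L[𝕂] EuclideanSpace 𝕂 (Fin p)) :=
    { toFun := fun w => (EuclideanSpace.proj j : EuclideanSpace 𝕂 (Fin k) →L[𝕂] 𝕂).smulRight w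
      map_add' := fun w w' => by ext; simp
      map_smul' := fun c w => by
        ext v i
        simp }
  have h : A = fun x => ∑ j, L j (A x (EuclideanSpace.single j 1)) := by
    ext x v
    have hv : v = ∑ j, v j • EuclideanSpace.single j (1 : 𝕂) := by
      ext i
      simp [Finset.sum_apply, Pi.single_apply]
    conv_lhs => rw [hv]
    simp [L]
  rw [h]
  exact IsRegularMap.sum _ fun j => (hA j).comp_linear (L j)

variable (ξ : AlgebraicVectorBundle 𝕂 k X)

/-- The fibre of an algebraic vector bundle as a subspace of a Euclidean space. -/
def AlgebraicVectorBundle.fiberE (x : X) : Submodule 𝕂 (EuclideanSpace 𝕂 (Fin ξ.p)) :=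
  (ξ.fiber x).comap (WithLp.linearEquiv 2 𝕂 (Fin ξ.p → 𝕂)).toLinearMap

theorem AlgebraicVectorBundle.mem_fiberE {x : X} {v : EuclideanSpace 𝕂 (Fin ξ.p)} :
    v ∈ ξ.fiberE x ↔ WithLp.ofLp v ∈ ξ.fiber x := Iff.rfl

/-- The projections on the fibres of an algebraic vector bundle over a compact set depend regularly
on the base point. -/
theorem AlgebraicVectorBundle.isRegularMap_starProjection (hX : IsCompact X) :
    IsRegularMap X fun x => (ξ.fiberE x).starProjection := by
  intro φ
  refine isRegularFun_of_locally hX fun x₀ => ?_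
  obtain ⟨U, hUo, hx₀, Φ, hΦ, hfst, hlin⟩ := ξ.locally_trivial x₀ x₀.2
  have hU : U ⊆ X := by
    obtain ⟨Z, -, rfl⟩ := hUo
    exact Set.sdiff_subset
  refine ⟨U, hUo, hx₀, hU, ?_⟩
  let col (x : U) (v : Fin k → 𝕂) : Fin ξ.p → 𝕂 := (Φ ⟨(x, v), ⟨x.2, Set.mem_univ v⟩⟩).1.2
  let B (x : U) : EuclideanSpace 𝕂 (Fin k) →L[𝕂] EuclideanSpace 𝕂 (Fin ξ.p) :=
    LinearMap.toContinuousLinearMap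
      ((WithLp.linearEquiv 2 𝕂 (Fin ξ.p → 𝕂)).symm.toLinearMap ∘ₗ (hlin x x.2).mk' (col x) ∘ₗ
        (WithLp.linearEquiv 2 𝕂 (Fin k → 𝕂)).toLinearMap)
  have hB (x : U) (v : EuclideanSpace 𝕂 (Fin k)) :
      B x v = WithLp.toLp 2 (col x (WithLp.ofLp v)) := rfl
  have hBreg : IsRegularMap U B := by
    refine isRegularMap_of_columns fun j => ?_
    intro η
    -- The `j`-th column at `x` is the vector part of `Φ (x, e_j)`. Thus a regular function on `U ×
    -- 𝕂^k` is restricted to the affine slice through `e_j`, along which polynomial functions pull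
    -- back to polynomial functions.
    let η' : Module.Dual ℝ ((Fin m → ℝ) × (Fin ξ.p → 𝕂)) :=
      η ∘ₗ (WithLp.linearEquiv 2 ℝ (Fin ξ.p → 𝕂)).symm.toLinearMap ∘ₗ LinearMap.snd ℝ _ _
    obtain ⟨g, h, hg, hh, h0, hgh⟩ := hΦ.1 η'
    let w : (Fin m → ℝ) × (Fin k → 𝕂) := (0, WithLp.ofLp (EuclideanSpace.single j (1 : 𝕂)))
    have hw (x : Fin m → ℝ) : LinearMap.inl ℝ (Fin m → ℝ) (Fin k → 𝕂) x + w = (x, w.2) := by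
      simp [w]
    refine ⟨_, _, hg.comp_affine (LinearMap.inl ℝ _ _) w, hh.comp_affine (LinearMap.inl ℝ _ _) w,
      fun x hx => ?_, fun x => ?_⟩
    · rw [hw]
      exact h0 _ ⟨hx, trivial⟩
    · rw [hw]
      exact hgh ⟨(x, w.2), ⟨x.2, trivial⟩⟩
  have hinj (x : U) (v : EuclideanSpace 𝕂 (Fin k)) (hv : B x v = 0) : v = 0 := by
    have h1 : col x (WithLp.ofLp v) = col x 0 := by
      have h2 : col x 0 = 0 := ((hlin x x.2).mk' (col x)).map_zero
      rw [h2]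
      exact congrArg WithLp.ofLp hv
    have h3 : (⟨(x, WithLp.ofLp v), ⟨x.2, Set.mem_univ _⟩⟩ :
        (U ×ˢ Set.univ : Set ((Fin m → ℝ) × (Fin k → 𝕂)))) = ⟨(x, 0), ⟨x.2, Set.mem_univ _⟩⟩ :=
      Φ.injective (Subtype.ext (Prod.ext ((hfst _).trans
        (hfst ⟨(x, 0), ⟨x.2, Set.mem_univ _⟩⟩).symm) h1))
    have h4 := congrArg (fun q => q.1.2) h3
    exact (WithLp.linearEquiv 2 𝕂 (Fin k → 𝕂)).injective h4
  have hrange (x : U) : (B x).range = ξ.fiberE ⟨x, hU x.2⟩ := by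
    apply le_antisymm
    · rintro _ ⟨v, rfl⟩
      have h1 := (Φ ⟨(x, WithLp.ofLp v), ⟨x.2, Set.mem_univ _⟩⟩).2
      obtain ⟨-, h2, h3⟩ := h1
      rw [AlgebraicVectorBundle.mem_fiberE]
      have h4 : (⟨_, h2⟩ : X) = ⟨x, hU x.2⟩ := Subtype.ext (hfst _)
      rw [← h4]
      exact h3
    · intro w hw
      obtain ⟨⟨⟨x', v⟩, hx', hv'⟩, hq⟩ := Φ.surjective
        ⟨(x, WithLp.ofLp w), ⟨x.2, hU x.2, hw⟩⟩
      have h1 : x' = x := by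
        have := hfst ⟨(x', v), hx', hv'⟩
        rw [hq] at this
        exact this.symm
      subst h1
      refine ⟨WithLp.toLp 2 v, ?_⟩
      have h2 : col x v = WithLp.ofLp w := congrArg (fun q => q.1.2) hq
      change WithLp.toLp 2 (col x v) = w
      rw [h2]
  -- The columns of `B x` form a frame of the fibre; with `P = 1` the formula becomes `B (B†B)⁻¹
  -- B†`.
  have hu (x : U) : IsUnit (gram (B x) 1) :=
    isUnit_gram (IsStarProjection.one _) fun v _ hv => hinj x v hv
  have hE (x : U) : imageProj (B x) 1 = (ξ.fiberE ⟨x, hU x.2⟩).starProjection :=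
    imageProj_eq (IsStarProjection.one _) (ContinuousLinearMap.comp_id _) (hu x)
      isStarProjection_starProjection (by rw [Submodule.range_starProjection, hrange])
  have hreg := hBreg.imageProj (isRegularMap_const 1) hu
  simp only [hE] at hreg
  exact hreg φ

/-- If every bundle over `X` is algebraic, then every map to the Grassmannian is the image of a
regular family of projections under a continuous family of operators. -/
theorem EveryBundleAlgebraic.exists_isomorphism {𝕂 : Type u} [RCLike 𝕂]
    (h : EveryBundleAlgebraic 𝕂 k X) (hX : IsCompact X) {n : ℕ} (f : C(X, Grassmannian 𝕂 n k)) :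
    ∃ (p : ℕ) (E : X → EuclideanSpace 𝕂 (Fin p) →L[𝕂] EuclideanSpace 𝕂 (Fin p))
      (Φ : C(X, EuclideanSpace 𝕂 (Fin p) →L[𝕂] EuclideanSpace 𝕂 (Fin n))),
      IsRegularMap X E ∧ (∀ x, IsStarProjection (E x)) ∧
      (∀ x v, E x v = v → Φ x v = 0 → v = 0) ∧
      ∀ x, (Φ x ∘L E x).range = (f x).proj.range := by
  obtain ⟨ξ, ψ, hψ⟩ := h (TautFiber f)
  let E (x : X) := (ξ.fiberE x).starProjection
  have hEreg : IsRegularMap X E := ξ.isRegularMap_starProjection hX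
  have := finiteDimensional_real_clm (𝕂 := 𝕂) (p := ξ.p) (n := ξ.p)
  have hEmem (x : X) (v : EuclideanSpace 𝕂 (Fin ξ.p)) : WithLp.ofLp (E x v) ∈ ξ.fiber x :=
    Submodule.starProjection_apply_mem (ξ.fiberE x) v
  have hEself (x : X) {v : EuclideanSpace 𝕂 (Fin ξ.p)} (hv : WithLp.ofLp v ∈ ξ.fiber x) :
      E x v = v := Submodule.starProjection_eq_self_iff.2 (ξ.mem_fiberE.2 hv)
  let Elin (x : X) : EuclideanSpace 𝕂 (Fin ξ.p) →ₗ[𝕂] ξ.fiber x :=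
    LinearMap.codRestrict (ξ.fiber x) ((WithLp.linearEquiv 2 𝕂 (Fin ξ.p → 𝕂)).toLinearMap ∘ₗ
      (E x).toLinearMap) (hEmem x)
  -- The inverse isomorphism `ψ⁻¹` is extended to the whole ambient space by projecting onto the
  -- fibre first.
  let Φ (x : X) : EuclideanSpace 𝕂 (Fin ξ.p) →L[𝕂] EuclideanSpace 𝕂 (Fin n) :=
    LinearMap.toContinuousLinearMap (TautFiber.incl ∘ₗ (ψ x).symm.toLinearMap ∘ₗ Elin x)
  have hΦ (x : X) (v : EuclideanSpace 𝕂 (Fin ξ.p)) :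
      Φ x v = TautFiber.incl ((ψ x).symm ⟨WithLp.ofLp (E x v), hEmem x v⟩) := rfl
  have hΦc : Continuous Φ := by
    -- In finite dimension continuity may be tested on a fixed `v`: then `x ↦ (x, E x v)` is a
    -- continuous section of the algebraic bundle, carried by the inverse homeomorphism to the
    -- tautological one.
    rw [continuous_clm_apply]
    intro v
    let H := hψ.homeomorph
    have h1 : Continuous fun x : X =>
        (⟨(x, WithLp.ofLp (E x v)), hEmem x v⟩ : ξ.Total) := by
      refine Continuous.subtype_mk (continuous_id.prodMk ?_) _
      exact (PiLp.continuous_ofLp 2 _).comp (hEreg.continuous.clm_apply continuous_const)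
    have h2 := continuous_snd.comp ((continuous_tautEmb f).comp (H.symm.continuous.comp h1))
    refine Continuous.congr h2 fun x => ?_
    have h3 : H.symm ⟨(x, WithLp.ofLp (E x v)), hEmem x v⟩ =
        ⟨x, (ψ x).symm ⟨WithLp.ofLp (E x v), hEmem x v⟩⟩ := by
      rw [Homeomorph.symm_apply_eq]
      refine Subtype.ext (Prod.ext rfl ?_)
      change _ = ((ψ x ((ψ x).symm ⟨WithLp.ofLp (E x v), hEmem x v⟩) : ξ.fiber x) :
        Fin ξ.p → 𝕂)
      rw [LinearEquiv.apply_symm_apply]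
    simp only [Function.comp_apply, h3]
    rfl
  refine ⟨ξ.p, E, ⟨Φ, hΦc⟩, hEreg, fun x => isStarProjection_starProjection,
    fun x v hv h0 => ?_, fun x => ?_⟩
  · change Φ x v = 0 at h0
    rw [hΦ] at h0
    have h1 := TautFiber.incl_injective f (h0.trans (map_zero _).symm)
    have h2 := (LinearEquiv.map_eq_zero_iff _).1 h1
    have h3 : WithLp.ofLp (E x v) = 0 := congrArg Subtype.val h2
    rw [hv] at h3
    exact (WithLp.linearEquiv 2 𝕂 (Fin ξ.p → 𝕂)).injective h3
  · rw [Grassmannian.range_proj]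
    apply le_antisymm
    · rintro _ ⟨v, rfl⟩
      exact TautFiber.incl_mem f ((ψ x).symm ⟨WithLp.ofLp (E x (E x v)), hEmem x (E x v)⟩)
    · intro w hw
      let w' : TautFiber f x := ⟨w, hw⟩
      have hw' := hEself x (v := WithLp.toLp 2 ((ψ x w' : ξ.fiber x) : Fin ξ.p → 𝕂)) (ψ x w').2
      refine ⟨WithLp.toLp 2 ((ψ x w' : ξ.fiber x) : Fin ξ.p → 𝕂), ?_⟩
      change Φ x (E x _) = w
      rw [hw', hΦ]
      simp only [hw']
      change TautFiber.incl ((ψ x).symm (ψ x w')) = w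
      rw [LinearEquiv.symm_apply_apply]
      rfl

end AlgebraicBundles

end

end StableAlg

namespace StableAlg

noncomputable section

/-! ### Deformation of families of continuous maps into regular maps -/

section Deformation

open scoped unitInterval

variable {𝕂 : Type u} [RCLike 𝕂] {n k m : ℕ} {X : Set (Fin m → ℝ)}

/-- Every continuous map to the Grassmannian is close to a regular one. -/
theorem EveryBundleAlgebraic.exists_regular_near (h : EveryBundleAlgebraic 𝕂 k X)
    (hX : IsCompact X) (f : C(X, Grassmannian 𝕂 n k)) :
    ∃ A : X → EuclideanSpace 𝕂 (Fin n) →L[𝕂] EuclideanSpace 𝕂 (Fin n),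
      IsRegularMap X A ∧ (∀ x, IsStarProjection (A x)) ∧
      ∀ x, IsUnit (intertwiner (A x) (f x).proj) := by
  have : CompactSpace X := isCompact_iff_compactSpace.1 hX
  obtain ⟨p, E, Φ, hE, hEp, hinj, hrange⟩ := h.exists_isomorphism hX f
  obtain ⟨R, hR, hRu, -, hRreg⟩ := exists_regular_family (D := Unit) hE hEp
    ⟨fun y => (f y.2).proj, (continuous_proj_comp f).comp continuous_snd⟩
    (fun y => (f y.2).isStarProjection_proj) (Φ.comp ContinuousMap.snd)
    (fun y => hinj y.2) (fun y => hrange y.2)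
  exact ⟨fun x => R ((), x), hRreg (), fun x => hR _, fun x => hRu ((), x)⟩

/-- A family of continuous maps, parametrized by a compact contractible space, is close to a family
of regular maps. -/
theorem EveryBundleAlgebraic.exists_regular_family_near (h : EveryBundleAlgebraic 𝕂 k X)
    (hX : IsCompact X) {D : Type*} [TopologicalSpace D] [CompactSpace D] [T2Space D]
    [ContractibleSpace D] (F : C(D, C(X, Grassmannian 𝕂 n k))) :
    ∃ R : C(D × X, EuclideanSpace 𝕂 (Fin n) →L[𝕂] EuclideanSpace 𝕂 (Fin n)),
      (∀ y, IsStarProjection (R y)) ∧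
      (∀ y, IsUnit (intertwiner (R y) (F y.1 y.2).proj)) ∧
      (∀ y, Module.finrank 𝕂 (R y).range = k) ∧ ∀ s, IsRegularMap X fun x => R (s, x) := by
  have : CompactSpace X := isCompact_iff_compactSpace.1 hX
  obtain ⟨s₀, ⟨κ⟩⟩ := id_nullhomotopic D
  -- The reversed contraction runs from the constant map `s₀` to the identity, so `U` conjugates the
  -- projections of `F s₀` into those of `F s`.
  let κ' := κ.symm
  obtain ⟨A, hA, hAp, hAu⟩ := h.exists_regular_near hX (F s₀)
  have := finiteDimensional_real_clm (𝕂 := 𝕂) (p := n) (n := n)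
  have hF : Continuous fun y : D × X => (F y.1 y.2).proj :=
    Grassmannian.continuous_proj.comp F.uncurry.continuous
  obtain ⟨U, hU⟩ := exists_continuous_conj (K := D × X)
    ⟨fun z : I × (D × X) => (F (κ' (z.1, z.2.1)) z.2.2).proj, hF.comp
      (f := fun z : I × (D × X) => (κ' (z.1, z.2.1), z.2.2)) (by fun_prop)⟩
    fun z => (F _ _).isStarProjection_proj
  have hU' (y : D × X) : U y * (F s₀ y.2).proj = (F y.1 y.2).proj * U y := by
    have := (hU y).2
    simpa [κ'] using this
  -- `W` carries the range of the regular projection `A` onto that of `F s₀`, so `U * W` plays the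
  -- role of the bundle isomorphism, with `A` as the algebraic model.
  let W (y : D × X) := intertwiner (F s₀ y.2).proj (A y.2)
  have hWu (y : D × X) : IsUnit (W y) :=
    isUnit_intertwiner_symm (hAp _) (F s₀ y.2).isStarProjection_proj (hAu y.2)
  have hW (y : D × X) : W y * A y.2 = (F s₀ y.2).proj * W y :=
    intertwiner_mul_eq (F s₀ y.2).isStarProjection_proj (hAp _)
  have hWc : Continuous W := continuous_intertwiner
    ((continuous_proj_comp (F s₀)).comp continuous_snd) (hA.continuous.comp continuous_snd)
  have hΦu (y : D × X) : IsUnit (U y * W y) := (hU y).1.mul (hWu y)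
  obtain ⟨R, hR, hRu, hRk, hRreg⟩ := exists_regular_family hA hAp
    ⟨fun y : D × X => (F y.1 y.2).proj, hF⟩ (fun y => (F y.1 y.2).isStarProjection_proj)
    ⟨fun y => U y * W y, U.continuous.mul hWc⟩
    (fun y v _ hv => eq_zero_of_isUnit (hΦu y) hv)
    (fun y => range_comp_of_mul_eq (hΦu y) (by
      change U y * W y * A y.2 = (F y.1 y.2).proj * (U y * W y)
      rw [mul_assoc, hW, ← mul_assoc, hU', mul_assoc]))
  exact ⟨R, hR, hRu, fun y => (hRk y).trans (F y.1 y.2).finrank_range_proj, hRreg⟩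

/-- A family of continuous maps, parametrized by a compact contractible space, can be deformed to a
family of regular maps, in such a way that the regular maps of the family remain regular. -/
theorem EveryBundleAlgebraic.exists_deformation (h : EveryBundleAlgebraic 𝕂 k X)
    (hX : IsCompact X) {D : Type*} [TopologicalSpace D] [CompactSpace D] [T2Space D]
    [ContractibleSpace D] (F : C(D, C(X, Grassmannian 𝕂 n k))) :
    ∃ H : C(I × D, C(X, Grassmannian 𝕂 n k)), (∀ s, H (0, s) = F s) ∧
      (∀ s, IsRegularMap X fun x => (H (1, s) x).proj) ∧
      ∀ s, IsRegularMap X (fun x => (F s x).proj) →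
        ∀ t, IsRegularMap X fun x => (H (t, s) x).proj := by
  have : CompactSpace X := isCompact_iff_compactSpace.1 hX
  obtain ⟨R, hR, hRu, hRk, hRreg⟩ := h.exists_regular_family_near hX F
  have hF : Continuous fun y : D × X => (F y.1 y.2).proj :=
    Grassmannian.continuous_proj.comp F.uncurry.continuous
  have hP (y : D × X) := (F y.1 y.2).isStarProjection_proj
  let M : (I × D) × X → EuclideanSpace 𝕂 (Fin n) →L[𝕂] EuclideanSpace 𝕂 (Fin n) :=
    fun z => pathProj z.1.1 (F z.1.2 z.2).proj (R (z.1.2, z.2))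
  have hM : Continuous M := by
    have h1 : Continuous fun z : (I × D) × X => (F z.1.2 z.2).proj :=
      hF.comp (f := fun z : (I × D) × X => (z.1.2, z.2)) (by fun_prop)
    exact continuous_pathProj (by fun_prop) h1 (by fun_prop) (fun z => z.1.1.2)
      (fun z => hP (z.1.2, z.2)) (fun z => hR _) fun z => hRu (z.1.2, z.2)
  have hMp (z : (I × D) × X) : IsStarProjection (M z) :=
    isStarProjection_pathProj (hP (z.1.2, z.2)) (hR _) (hRu (z.1.2, z.2)) z.1.1.2
  have hMk (z : (I × D) × X) : Module.finrank 𝕂 (M z).range = k :=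
    (finrank_range_pathProj (hP (z.1.2, z.2)) (hR _) (hRu (z.1.2, z.2)) z.1.1.2).trans
      (F z.1.2 z.2).finrank_range_proj
  let G : C((I × D) × X, Grassmannian 𝕂 n k) :=
    ⟨fun z => Grassmannian.ofProj (M z) (hMk z), Grassmannian.continuous_ofProj hM hMp hMk⟩
  have hG (t : I) (s : D) (x : X) : (G.curry (t, s) x).proj =
      pathProj t (F s x).proj (R (s, x)) := Grassmannian.proj_ofProj (hMp _) (hMk _)
  refine ⟨G.curry, fun s => ?_, fun s => ?_, fun s hs t => ?_⟩
  · ext1 x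
    apply Grassmannian.proj_injective
    rw [hG]
    exact pathProj_zero (hP (s, x)) (hR _) (hRu _)
  · convert hRreg s using 2 with x
    rw [hG]
    exact pathProj_one (hP (s, x)) (hR _) (hRu _)
  · simp only [hG]
    exact IsRegularMap.pathProj t.2 hs (hRreg s) (fun x => hP (s, x)) (fun x => hR _)
      fun x => hRu (s, x)

end Deformation

end

end StableAlg

namespace StableAlg

noncomputable section

/-! ### Weak homotopy equivalences from deformations -/

section Collar

open scoped unitInterval

/-- The map of the unit interval which collapses the collars `[0, 1/4]` and `[3/4, 1]`. -/
def collapse : C(I, I) :=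
  ⟨fun t => Set.projIcc (0 : ℝ) 1 zero_le_one (2 * t - 1 / 2), by fun_prop⟩

/-- A function on the unit interval which vanishes at the ends and is `1` outside the collars. -/
def bump : C(I, I) :=
  ⟨fun t => Set.projIcc (0 : ℝ) 1 zero_le_one (4 * t) *
    Set.projIcc (0 : ℝ) 1 zero_le_one (4 * (1 - t)), by fun_prop⟩

theorem collapse_zero : collapse 0 = 0 := Set.projIcc_of_le_left zero_le_one (by norm_num)

theorem collapse_one : collapse 1 = 1 := Set.projIcc_of_right_le zero_le_one (by norm_num)

theorem bump_zero : bump 0 = 0 := by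
  have : Set.projIcc (0 : ℝ) 1 zero_le_one (4 * (0 : I)) = 0 :=
    Set.projIcc_of_le_left zero_le_one (by norm_num)
  simp only [bump, ContinuousMap.coe_mk, this, zero_mul]

theorem bump_one : bump 1 = 0 := by
  have : Set.projIcc (0 : ℝ) 1 zero_le_one (4 * (1 - (1 : I))) = 0 :=
    Set.projIcc_of_le_left zero_le_one (by norm_num)
  simp only [bump, ContinuousMap.coe_mk, this, mul_zero]

/-- On `[1/4, 3/4]` both `4t` and `4(1 - t)` are at least `1`, so `bump` is `1`; outside, `2t - 1/2`
leaves `(0, 1)` and is clamped to an end. -/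
theorem collapse_of_bump_ne_one {t : I} (h : bump t ≠ 1) : collapse t = 0 ∨ collapse t = 1 := by
  by_contra! hc
  refine h ?_
  have h1 : (1 : ℝ) / 4 ≤ t := by
    by_contra! ht
    exact hc.1 (Set.projIcc_of_le_left zero_le_one (by linarith))
  have h2 : (t : ℝ) ≤ 3 / 4 := by
    by_contra! ht
    exact hc.2 (Set.projIcc_of_right_le zero_le_one (by linarith))
  have h3 : Set.projIcc (0 : ℝ) 1 zero_le_one (4 * t) = 1 :=
    Set.projIcc_of_right_le zero_le_one (by linarith)
  have h4 : Set.projIcc (0 : ℝ) 1 zero_le_one (4 * (1 - t)) = 1 :=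
    Set.projIcc_of_right_le zero_le_one (by linarith)
  simp only [bump, ContinuousMap.coe_mk, h3, h4, mul_one]

/-- The linear homotopy from the identity to `collapse`. -/
def collapseHomotopy : C(I × I, I) :=
  ⟨fun z => Set.projIcc (0 : ℝ) 1 zero_le_one ((1 - z.1) * z.2 + z.1 * collapse z.2),
    by fun_prop⟩

theorem collapseHomotopy_zero_left (t : I) : collapseHomotopy (0, t) = t := by
  simp [collapseHomotopy]

theorem collapseHomotopy_one_left (t : I) : collapseHomotopy (1, t) = collapse t := by
  simp [collapseHomotopy]

theorem collapseHomotopy_zero_right (u : I) : collapseHomotopy (u, 0) = 0 := by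
  simp [collapseHomotopy, collapse_zero]

theorem collapseHomotopy_one_right (u : I) : collapseHomotopy (u, 1) = 1 := by
  simp [collapseHomotopy, collapse_one]

variable {ι : Type*}

/-- The map of the cube which collapses a collar of the boundary. -/
def cubeCollapse (ι : Type*) : C(ι → I, ι → I) := ⟨fun s i => collapse (s i), by fun_prop⟩

/-- The linear homotopy from the identity of the cube to `cubeCollapse`. -/
def cubeCollapseHomotopy (ι : Type*) : C(I × (ι → I), ι → I) :=
  ⟨fun z i => collapseHomotopy (z.1, z.2 i), by fun_prop⟩

theorem cubeCollapseHomotopy_mem_boundary (u : I) {s : ι → I} (hs : s ∈ Cube.boundary ι) :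
    cubeCollapseHomotopy ι (u, s) ∈ Cube.boundary ι := by
  obtain ⟨i, hi⟩ := hs
  refine ⟨i, hi.imp (fun h => ?_) fun h => ?_⟩
  · simp only [cubeCollapseHomotopy, ContinuousMap.coe_mk, h, collapseHomotopy_zero_right]
  · simp only [cubeCollapseHomotopy, ContinuousMap.coe_mk, h, collapseHomotopy_one_right]

theorem cubeCollapseHomotopy_zero (s : ι → I) : cubeCollapseHomotopy ι (0, s) = s :=
  funext fun i => collapseHomotopy_zero_left (s i)

theorem cubeCollapseHomotopy_one (s : ι → I) :
    cubeCollapseHomotopy ι (1, s) = cubeCollapse ι s :=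
  funext fun i => collapseHomotopy_one_left (s i)

theorem cubeCollapse_mem_boundary {s : ι → I} (hs : s ∈ Cube.boundary ι) :
    cubeCollapse ι s ∈ Cube.boundary ι := by
  rw [← cubeCollapseHomotopy_one]
  exact cubeCollapseHomotopy_mem_boundary 1 hs

/-- A function on the cube which vanishes on the boundary and is `1` outside a collar. -/
def cubeBump (ι : Type*) [Fintype ι] : C(ι → I, I) := ⟨fun s => ∏ i, bump (s i), by fun_prop⟩

theorem cubeBump_of_mem_boundary [Fintype ι] {s : ι → I} (hs : s ∈ Cube.boundary ι) :
    cubeBump ι s = 0 := by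
  obtain ⟨i, hi⟩ := hs
  refine Finset.prod_eq_zero (Finset.mem_univ i) ?_
  rcases hi with hi | hi
  · rw [hi, bump_zero]
  · rw [hi, bump_one]

theorem cubeCollapse_of_cubeBump_ne_one [Fintype ι] {s : ι → I} (h : cubeBump ι s ≠ 1) :
    cubeCollapse ι s ∈ Cube.boundary ι := by
  by_contra hc
  refine h (Finset.prod_eq_one fun i _ => ?_)
  by_contra hi
  exact hc ⟨i, collapse_of_bump_ne_one hi⟩

instance contractibleSpace_unitInterval : ContractibleSpace I :=
  (convex_Icc (0 : ℝ) 1).contractibleSpace ⟨0, by simp⟩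

instance contractibleSpace_cube : ContractibleSpace (ι → I) := by
  rw [contractible_iff_id_nullhomotopic]
  exact ⟨0, ⟨{
    toFun := fun z i => unitInterval.symm z.1 * z.2 i
    continuous_toFun := by fun_prop
    map_zero_left := fun s => by ext1 i; simp
    map_one_left := fun s => by ext1 i; simp }⟩⟩

/-- A generalized loop is homotopic to its composition with `cubeCollapse`. -/
theorem homotopicRel_comp_cubeCollapse {A : Type*} [TopologicalSpace A] {a : A}
    {γ : C(ι → I, A)} (hγ : ∀ s ∈ Cube.boundary ι, γ s = a) :
    γ.HomotopicRel (γ.comp (cubeCollapse ι)) (Cube.boundary ι) :=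
  ⟨{ toContinuousMap := γ.comp (cubeCollapseHomotopy ι)
     map_zero_left := fun s => congrArg γ (cubeCollapseHomotopy_zero s)
     map_one_left := fun s => congrArg γ (cubeCollapseHomotopy_one s)
     prop' := fun u s hs =>
       (hγ _ (cubeCollapseHomotopy_mem_boundary u hs)).trans (hγ s hs).symm }⟩

end Collar

/-! ### Compression of families into a subspace -/

section Compression

open scoped unitInterval

variable {Y : Type*} [TopologicalSpace Y] (q : Y → Prop)

/-- Compact contractible families in `Y` can be deformed into the subspace defined by `q`, within
this subspace where they already lie in it. -/
def HasDeformations : Prop :=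
  ∀ (D : Type) [TopologicalSpace D] [CompactSpace D] [T2Space D] [ContractibleSpace D]
    (F : C(D, Y)), ∃ H : C(I × D, Y), (∀ s, H (0, s) = F s) ∧ (∀ s, q (H (1, s))) ∧
      ∀ s, q (F s) → ∀ t, q (H (t, s))

variable {q}

/-- A family which lies in the subspace on a collar can be deformed into the subspace relative to
the boundary. -/
theorem HasDeformations.exists_compression (hq : HasDeformations q) {D : Type}
    [TopologicalSpace D] [CompactSpace D] [T2Space D] [ContractibleSpace D] (F : C(D, Y))
    (τ : C(D, I)) (hτ : ∀ s, τ s ≠ 1 → q (F s)) :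
    ∃ K : C(I × D, Y), (∀ s, K (0, s) = F s) ∧ (∀ s, q (K (1, s))) ∧
      ∀ s, τ s = 0 → ∀ u, K (u, s) = F s := by
  obtain ⟨H, H0, H1, Hq⟩ := hq D F
  -- Time is slowed down by `τ`. Where `τ = 1` the deformation runs to its end; where `τ ≠ 1` the
  -- family starts in the subspace and stays there; where `τ = 0` it does not move.
  refine ⟨H.comp ⟨fun z => (z.1 * τ z.2, z.2), by fun_prop⟩, fun s => ?_, fun s => ?_,
    fun s hs u => ?_⟩
  · simp [H0]
  · by_cases hs : τ s = 1
    · simpa [hs] using H1 s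
    · exact Hq s (hτ s hs) _
  · simp [hs, H0]

/-- The inclusion of a subspace into which there are deformations is a weak homotopy
equivalence. -/
theorem HasDeformations.isWeakHomotopyEquiv (hq : HasDeformations q) :
    IsWeakHomotopyEquiv (⟨Subtype.val, continuous_subtype_val⟩ : C({y // q y}, Y)) := by
  refine ⟨⟨?_, ?_⟩, fun N _ a => ⟨?_, ?_⟩⟩
  · intro x y
    refine Quotient.inductionOn₂ x y fun a b hab => Quotient.sound ?_
    obtain ⟨p⟩ : Joined a.1 b.1 := Quotient.exact hab
    have h0 : p (collapse 0) = a.1 := by rw [collapse_zero, p.source]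
    have h1 : p (collapse 1) = b.1 := by rw [collapse_one, p.target]
    -- After `collapse` the path rests at its end points, which lie in the subspace, on the collars;
    -- as `bump` vanishes at `0` and `1`, the ends stay fixed.
    obtain ⟨K, -, K1, Kτ⟩ := hq.exists_compression (p.toContinuousMap.comp collapse) bump
      fun s hs => by
        change q (p (collapse s))
        rcases collapse_of_bump_ne_one hs with h | h <;> rw [h]
        · rw [p.source]
          exact a.2
        · rw [p.target]
          exact b.2
    exact ⟨{
      toFun := fun s => ⟨K (1, s), K1 s⟩
      continuous_toFun := by fun_prop
      source' := Subtype.ext ((Kτ 0 bump_zero 1).trans h0)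
      target' := Subtype.ext ((Kτ 1 bump_one 1).trans h1) }⟩
  · intro y
    refine Quotient.inductionOn y fun y => ?_
    obtain ⟨H, H0, H1, -⟩ := hq Unit (ContinuousMap.const _ y)
    refine ⟨Quotient.mk _ ⟨H (1, ()), H1 ()⟩, Quotient.sound (Joined.symm ?_)⟩
    exact ⟨{
      toFun := fun t => H (t, ())
      continuous_toFun := by fun_prop
      source' := H0 ()
      target' := rfl }⟩
  · intro x y
    refine Quotient.inductionOn₂ x y fun γ₀ γ₁ hγ => Quotient.sound ?_
    obtain ⟨F⟩ : ContinuousMap.HomotopicRel _ _ _ := Quotient.exact hγ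
    have F0 (s : Fin N → I) : F (0, s) = (γ₀ s).1 := F.apply_zero s
    have F1 (s : Fin N → I) : F (1, s) = (γ₁ s).1 := F.apply_one s
    have Fb (t : I) {s : Fin N → I} (hs : s ∈ Cube.boundary (Fin N)) : F (t, s) = a.1 :=
      (F.eq_fst t hs).trans (congrArg Subtype.val (γ₀.2 s hs))
    -- Collapsing both time and the cube puts the values near every face of `I × I^N` in the
    -- subspace: there they are values of `γ₀` or `γ₁`, or the base point.
    let F' : C(I × (Fin N → I), Y) := F.toContinuousMap.comp
      ⟨fun z => (collapse z.1, cubeCollapse (Fin N) z.2), by fun_prop⟩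
    have hF' (z : I × (Fin N → I)) : F' z = F (collapse z.1, cubeCollapse (Fin N) z.2) := rfl
    obtain ⟨K, -, K1, Kτ⟩ := hq.exists_compression F'
      ⟨fun z => bump z.1 * cubeBump (Fin N) z.2, by fun_prop⟩ fun z hz => by
        rw [hF']
        by_cases h : bump z.1 = 1
        · have h' : cubeBump (Fin N) z.2 ≠ 1 := fun h' => hz (by simp [h, h'])
          rw [Fb _ (cubeCollapse_of_cubeBump_ne_one h')]
          exact a.2
        · rcases collapse_of_bump_ne_one h with h | h <;> rw [h]
          · rw [F0]
            exact (γ₀ _).2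
          · rw [F1]
            exact (γ₁ _).2
    have K0' (s : Fin N → I) : K (1, (0, s)) = (γ₀ (cubeCollapse (Fin N) s)).1 := by
      rw [Kτ (0, s) (by simp [bump_zero]), hF', collapse_zero, F0]
    have K1' (s : Fin N → I) : K (1, (1, s)) = (γ₁ (cubeCollapse (Fin N) s)).1 := by
      rw [Kτ (1, s) (by simp [bump_one]), hF', collapse_one, F1]
    have Kb (t : I) {s : Fin N → I} (hs : s ∈ Cube.boundary (Fin N)) :
        K (1, (t, s)) = a.1 := by
      rw [Kτ (t, s) (by simp [cubeBump_of_mem_boundary hs]), hF',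
        Fb _ (cubeCollapse_mem_boundary hs)]
    -- The compression joins the collapsed loops; `homotopicRel_comp_cubeCollapse` then connects
    -- them to the original ones within the subspace.
    have hmid : (γ₀.1.comp (cubeCollapse (Fin N))).HomotopicRel
        (γ₁.1.comp (cubeCollapse (Fin N))) (Cube.boundary (Fin N)) :=
      ⟨{ toFun := fun z => ⟨K (1, z), K1 z⟩
         continuous_toFun := by fun_prop
         map_zero_left := fun s => Subtype.ext (K0' s)
         map_one_left := fun s => Subtype.ext (K1' s)
         prop' := fun t s hs => Subtype.ext ((Kb t hs).trans
          (congrArg Subtype.val (γ₀.2 _ (cubeCollapse_mem_boundary hs))).symm) }⟩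
    exact ((homotopicRel_comp_cubeCollapse γ₀.2).trans hmid).trans
      (homotopicRel_comp_cubeCollapse γ₁.2).symm
  · intro y
    refine Quotient.inductionOn y fun γ => ?_
    obtain ⟨K, K0, K1, Kτ⟩ := hq.exists_compression (γ.1.comp (cubeCollapse (Fin N)))
      (cubeBump (Fin N)) fun s hs => by
        have : γ.1 (cubeCollapse (Fin N) s) = a.1 :=
          γ.2 _ (cubeCollapse_of_cubeBump_ne_one hs)
        rw [ContinuousMap.comp_apply, this]
        exact a.2
    have Kb {s : Fin N → I} (hs : s ∈ Cube.boundary (Fin N)) (u : I) : K (u, s) = a.1 :=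
      (Kτ s (cubeBump_of_mem_boundary hs) u).trans (γ.2 _ (cubeCollapse_mem_boundary hs))
    let G : GenLoop (Fin N) {y // q y} a := ⟨⟨fun s => ⟨K (1, s), K1 s⟩, by fun_prop⟩,
      fun s hs => Subtype.ext (Kb hs 1)⟩
    refine ⟨Quotient.mk _ G, Quotient.sound ?_⟩
    -- The compression itself is the homotopy from the collapsed loop to one in the subspace, and it
    -- fixes the boundary.
    have hmid : (γ.1.comp (cubeCollapse (Fin N))).HomotopicRel
        (genLoopMap ⟨Subtype.val, continuous_subtype_val⟩ (Fin N) a G).1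
        (Cube.boundary (Fin N)) :=
      ⟨{ toContinuousMap := K
         map_zero_left := K0
         map_one_left := fun s => rfl
         prop' := fun t s hs => (Kb hs t).trans (γ.2 _ (cubeCollapse_mem_boundary hs)).symm }⟩
    exact ((homotopicRel_comp_cubeCollapse γ.2).trans hmid).symm

end Compression

end

end StableAlg

theorem theorem2p1 {𝕂 : Type*} [RCLike 𝕂] (n k m : ℕ) (X : Set (Fin m → ℝ))
    (hX : StableAlg.IsAlgebraicSet X) (hcompact : IsCompact X)
    (hbundle : StableAlg.EveryBundleAlgebraic 𝕂 k X) :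
    StableAlg.IsWeakHomotopyEquiv (StableAlg.algInclusion 𝕂 n k X) :=
  StableAlg.HasDeformations.isWeakHomotopyEquiv
    (q := fun f : C(X, StableAlg.Grassmannian 𝕂 n k) =>
      StableAlg.IsRegularMap X fun x => (f x).proj)
    fun _ _ _ _ _ F => hbundle.exists_deformation hcompact F
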